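/- Let $X$ be a metric space and $R$ a ring. For a subset $B\subseteq X$ and $r\ge 0$ let $N_r(B)=\{x\in X : d(x,B)\le r\}$. Let $C^n(X;R)$ be the $R$-module of all functions $\phi: X^{n+1}\to R$ ($n\ge 0$), with differential $(d\phi)(x_0,\dots,x_{n+1})=\sum_{i=0}^{n+1}(-1)^i\phi(x_0,\dots,\widehat{x_i},\dots,x_{n+1})$, and give $X^{n+1}$ the sup metric; $\Delta\subseteq X^{n+1}$ denotes the diagonal. * The coarse cohomology $HX^*(X;R)$ is the cohomology of the subcomplex $CX^*(X;R)\subseteq C^*(X;R)$ of those $\phi$ for which $\operatorname{supp}\phi\cap N_r(\Delta)$ is bounded for every $r\ge 0$. * For a topological space $Y$, the reduced Alexander–Spanier cohomology $\tilde H^n(Y;R)$, $n\ge 0$, is the cohomology in degree $n$ of the augmented complex $R\to C^0(Y;R)/C^0_0(Y;R)\to C^1(Y;R)/C^1_0(Y;R)\to\cdots$, where $C^n_0(Y;R)$ is the module of those $\phi$ for which the closure of $\operatorname{supp}\phi$ in $Y^{n+1}$ does not meet the diagonal, and $R\to C^0(Y;R)/C^0_0(Y;R)$ sends $r$ to the class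 of the constant function $r$. * A topological space $Y$ is locally acyclic (with coefficients in $R$) if for every $n\ge 0$, every $y\in Y$ and every neighbourhood $U$ of $y$ there is a neighbourhood $V\subseteq U$ of $y$ such that the inclusion $V\hookrightarrow U$ induces the zero map on the reduced singular homology $\tilde H_n(-;R)$. The metric space $X$ is locally acyclic at infinity if the complement of some bounded subset of $X$ is locally acyclic. * $X$ is uniformly acyclic at infinity (with coefficients in $R$) if there are non-decreasing functions $\mu,\rho:[0,\infty)\to[0,\infty)$ and a point $b_0\in X$ such that for every $r\ge 0$ and every non-empty $B\subseteq X$ of diameter $r$ with $d(b_0,B)\ge\mu(r)$, the inclusion $B\hookrightarrow N_{\rho(r)}(B)$ induces the zero map on reduced singular homology with coefficients in $R$ in every degree. Suppose that $X$ is unbounded, uniformly acyclic at infinity and locally acyclic at infinity, with coefficients in $R$. Then for every $b\in X$ $$HX^0(X;R)=0\qquad\text{and}\qquad HX^n(X;R)\;\cong\;\varinjlim_{r\in[0,\infty)}\tilde H^{n-1}(X-N_r(b);R)\quad\text{for all } n\ge 1,$$ where $N_r(b)=N_r(\{b\})$, the isomorphisms are isomorphisms of $R$-modules, and the direct limit is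 taken along the restriction maps $\tilde H^{n-1}(X-N_r(b);R)\to\tilde H^{n-1}(X-N_s(b);R)$ for $r\le s$. -/

import Mathlib

open CategoryTheory
open scoped NNReal Topology

universe u v

noncomputable section

namespace CoarseCohomology

/-! ### The basic complex of all cochains -/

section Basic

variable (X : Type u) (R : Type v) [Ring R]

/-- `C^n(X;R)`: all functions `X^{n+1} → R`. -/
abbrev Cochain (n : ℕ) : Type (max u v) := (Fin (n + 1) → X) → R

/-- `(dφ)(x₀,…,x_{n+1}) = ∑ i, (-1)^i φ(x₀,…,x̂ᵢ,…,x_{n+1})`. -/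
def coboundary (n : ℕ) : Cochain X R n →ₗ[R] Cochain X R (n + 1) where
  toFun φ := fun x => ∑ i : Fin (n + 2), (-1 : ℤ) ^ (i : ℕ) • φ (fun k => x (i.succAbove k))
  map_add' φ ψ := by
    funext x
    simp [Finset.sum_add_distrib]
  map_smul' r φ := by
    funext x
    simp only [Pi.smul_apply, RingHom.id_apply, Finset.smul_sum]
    exact Finset.sum_congr rfl fun i _ => smul_comm _ _ _

variable {X R}

theorem coboundary_apply {n : ℕ} (φ : Cochain X R n) (x : Fin (n + 2) → X) :
    coboundary X R n φ x =
      ∑ i : Fin (n + 2), (-1 : ℤ) ^ (i : ℕ) • φ (fun k => x (i.succAbove k)) := rfl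

theorem exists_face_of_coboundary_ne_zero {n : ℕ} {φ : Cochain X R n} {x : Fin (n + 2) → X}
    (h : coboundary X R n φ x ≠ 0) :
    ∃ i : Fin (n + 2), φ (fun k => x (i.succAbove k)) ≠ 0 := by
  by_contra! h'
  exact h (by simp [coboundary_apply, h'])

variable (X R)

theorem coboundary_coboundary (n : ℕ) (φ : Cochain X R n) :
    coboundary X R (n + 1) (coboundary X R n φ) = 0 := by
  funext x
  simp only [coboundary_apply, Finset.smul_sum, smul_smul, Pi.zero_apply]
  rw [← Finset.sum_product', Finset.univ_product_univ, ← Finset.sum_add_sum_compl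
    (Finset.univ.filter fun p : Fin (n + 3) × Fin (n + 2) => (p.1 : ℕ) ≤ (p.2 : ℕ))]
  rw [← eq_neg_iff_add_eq_zero, ← Finset.sum_neg_distrib]
  refine Finset.sum_bij
    (fun p hp => (p.2.succ, Fin.castLT p.1
      (lt_of_le_of_lt (by simpa using hp) p.2.isLt))) ?_ ?_ ?_ ?_
  · rintro ⟨i, j⟩ hp
    simp only [Finset.mem_filter, Finset.mem_univ, true_and, Finset.mem_compl,
      Fin.val_succ, Fin.val_castLT] at hp ⊢
    omega
  · rintro ⟨i, j⟩ hp ⟨i', j'⟩ hp' h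
    simp only [Prod.mk.injEq, Fin.ext_iff, Fin.val_castLT, Fin.val_succ] at h ⊢
    omega
  · rintro ⟨i, j⟩ hp
    simp only [Finset.mem_filter, Finset.mem_univ, true_and, Finset.mem_compl] at hp
    refine ⟨(j.castSucc, i.pred ?_), ?_, ?_⟩
    · rintro rfl
      simp at hp
    · simp only [Finset.mem_filter, Finset.mem_univ, true_and, Fin.val_castSucc, Fin.val_pred]
      omega
    · simp
  · rintro ⟨i, j⟩ hp
    simp only [Finset.mem_filter, Finset.mem_univ, true_and] at hp
    simp only [Fin.val_succ, Fin.val_castLT, ← neg_smul]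
    congr 1
    · ring
    · congr 1
      funext k
      congr 1
      simp only [Fin.succAbove, Fin.lt_def, Fin.ext_iff, Fin.val_castSucc, Fin.val_succ,
        Fin.val_castLT]
      split_ifs <;> simp_all <;> omega

/-- The diagonal `Δ ⊆ X^{n+1}`. -/
def diagonal (n : ℕ) : Set (Fin (n + 1) → X) := Set.range fun x : X => fun _ => x

/-- The value at `r` of a constant cochain: the augmentation `R → C^0(X;R)`. -/
def constCochain : R →ₗ[R] Cochain X R 0 where
  toFun r := fun _ => r
  map_add' _ _ := rfl
  map_smul' _ _ := rfl

end Basic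

/-! ### Coarse cohomology -/

section Coarse

variable (X : Type u) [MetricSpace X] (R : Type v) [Ring R]

/-- `CX^n(X;R)`: cochains whose support meets every neighbourhood `N_r(Δ)` of the diagonal in a
bounded set (`X^{n+1}` carries the sup metric). -/
def coarseCochain (n : ℕ) : Submodule R (Cochain X R n) where
  carrier := {φ | ∀ r : ℝ≥0,
    Bornology.IsBounded (Function.support φ ∩ Metric.cthickening r (diagonal X n))}
  add_mem' {φ ψ} hφ hψ r := by
    refine ((hφ r).union (hψ r)).subset ?_
    rintro x ⟨hx, hr⟩
    rcases Function.support_add φ ψ hx with h | h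
    · exact Or.inl ⟨h, hr⟩
    · exact Or.inr ⟨h, hr⟩
  zero_mem' r := by simp [Function.support_zero]
  smul_mem' c φ hφ r := by
    exact (hφ r).subset (Set.inter_subset_inter_left _ (Function.support_const_smul_subset c φ))

theorem coboundary_mem_coarseCochain {n : ℕ} {φ : Cochain X R n}
    (hφ : φ ∈ coarseCochain X R n) : coboundary X R n φ ∈ coarseCochain X R (n + 1) := by
  intro r
  rcases Set.eq_empty_or_nonempty
    (Function.support (coboundary X R n φ) ∩ Metric.cthickening r (diagonal X (n + 1))) with he | ⟨x₀, -⟩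
  · rw [he]
    exact Bornology.isBounded_empty
  obtain ⟨M, hM⟩ := (Metric.isBounded_iff_subset_closedBall (fun _ => x₀ 0)).1 (hφ (r + 1))
  refine (Metric.isBounded_iff_subset_closedBall (fun _ => x₀ 0)).2
    ⟨2 * ((r : ℝ) + 1) + max M 0, ?_⟩
  rintro x ⟨hx, hr⟩
  obtain ⟨i, hi⟩ := exists_face_of_coboundary_ne_zero hx
  have hr1 : (0 : ℝ) < (r : ℝ) + 1 := by positivity
  obtain ⟨_, ⟨y, rfl⟩, hy⟩ := Metric.mem_thickening_iff.1
    (Metric.cthickening_subset_thickening' hr1 (lt_add_one (r : ℝ)) _ hr)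
  have hy' := (dist_pi_lt_iff hr1).1 hy
  have hface : (fun k => x (i.succAbove k)) ∈ Metric.cthickening ((r + 1 : ℝ≥0) : ℝ)
      (diagonal X n) := by
    refine Metric.thickening_subset_cthickening _ _ (Metric.mem_thickening_iff.2
      ⟨fun _ => y, ⟨y, rfl⟩, ?_⟩)
    rw [NNReal.coe_add, NNReal.coe_one]
    exact (dist_pi_lt_iff hr1).2 fun k => hy' _
  have hb : dist (x (i.succAbove 0)) (x₀ 0) ≤ M :=
    (dist_le_pi_dist _ _ 0).trans (Metric.mem_closedBall.1 (hM ⟨hi, hface⟩))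
  refine Metric.mem_closedBall.2 ((dist_pi_le_iff (by positivity)).2 fun k => ?_)
  have h1 := dist_triangle (x k) y (x₀ 0)
  have h2 := dist_triangle y (x (i.succAbove 0)) (x₀ 0)
  have h3 := hy' k
  have h4 := hy' (i.succAbove 0)
  rw [dist_comm] at h4
  have h5 := le_max_left M 0
  linarith

/-- The cocycles of the complex `CX^*(X;R)`. -/
def coarseCocycles (n : ℕ) : Submodule R (Cochain X R n) :=
  coarseCochain X R n ⊓ LinearMap.ker (coboundary X R n)

/-- The coboundaries of the complex `CX^*(X;R)`. -/
def coarseCoboundaries : (n : ℕ) → Submodule R (Cochain X R n)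
  | 0 => ⊥
  | n + 1 => (coarseCochain X R n).map (coboundary X R n)

theorem coarseCoboundaries_le_coarseCocycles (n : ℕ) :
    coarseCoboundaries X R n ≤ coarseCocycles X R n := by
  cases n with
  | zero => exact bot_le
  | succ n =>
    rintro _ ⟨φ, hφ, rfl⟩
    exact ⟨coboundary_mem_coarseCochain X R hφ, coboundary_coboundary X R n φ⟩

/-- The coarse cohomology `HX^n(X;R)`: cocycles modulo coboundaries. -/
abbrev HX (n : ℕ) : Type (max u v) :=
  coarseCocycles X R n ⧸ (coarseCoboundaries X R n).submoduleOf (coarseCocycles X R n)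

end Coarse

/-! ### Reduced Alexander–Spanier cohomology -/

section AlexanderSpanier

variable (X : Type u) [TopologicalSpace X] (R : Type v) [Ring R]

/-- `‖φ‖`: the part of the diagonal that lies in the closure of the support of `φ`. -/
def diagSupport {X : Type u} [TopologicalSpace X] {R : Type v} [Ring R] {n : ℕ}
    (φ : Cochain X R n) : Set (Fin (n + 1) → X) :=
  diagonal X n ∩ closure (Function.support φ)

/-- `C_0^n(X;R)`: the locally zero cochains. -/
def locallyZero (n : ℕ) : Submodule R (Cochain X R n) where
  carrier := {φ | diagSupport φ = ∅}
  add_mem' {φ ψ} hφ hψ := by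
    rw [Set.mem_ofPred_eq, Set.eq_empty_iff_forall_notMem] at *
    rintro x ⟨hx, hc⟩
    have := closure_mono (Function.support_add φ ψ) hc
    rw [closure_union] at this
    rcases this with h | h
    · exact hφ x ⟨hx, h⟩
    · exact hψ x ⟨hx, h⟩
  zero_mem' := by
    simp [diagSupport, Function.support_zero]
  smul_mem' c φ hφ := by
    rw [Set.mem_ofPred_eq, Set.eq_empty_iff_forall_notMem] at *
    rintro x ⟨hx, hc⟩
    exact hφ x ⟨hx, closure_mono (Function.support_const_smul_subset c φ) hc⟩

variable {X R}

theorem coboundary_mem_locallyZero {n : ℕ} {φ : Cochain X R n} (hφ : φ ∈ locallyZero X R n) :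
    coboundary X R n φ ∈ locallyZero X R (n + 1) := by
  refine Set.eq_empty_of_forall_notMem ?_
  rintro _ ⟨⟨p, rfl⟩, hc⟩
  have hsub : Function.support (coboundary X R n φ) ⊆
      ⋃ i : Fin (n + 2), (fun (x : Fin (n + 2) → X) k => x (i.succAbove k)) ⁻¹' Function.support φ :=
    fun x hx => Set.mem_iUnion.2 (exists_face_of_coboundary_ne_zero hx)
  have hc' := closure_mono hsub hc
  rw [closure_iUnion_of_finite] at hc'
  obtain ⟨i, hi⟩ := Set.mem_iUnion.1 hc'
  have hcont : Continuous (fun (x : Fin (n + 2) → X) (k : Fin (n + 1)) => x (i.succAbove k)) := by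
    fun_prop
  exact Set.eq_empty_iff_forall_notMem.1 hφ (fun _ => p)
    ⟨⟨p, rfl⟩, hcont.closure_preimage_subset _ hi⟩

variable (R) in
/-- Pullback of cochains along a map, `(f^*φ)(x₀,…,xₙ) = φ(f x₀,…,f xₙ)`. -/
def pullback {X Y : Type u} (f : X → Y) (n : ℕ) : Cochain Y R n →ₗ[R] Cochain X R n where
  toFun φ := fun x => φ fun k => f (x k)
  map_add' _ _ := rfl
  map_smul' _ _ := rfl

theorem pullback_mem_locallyZero {X Y : Type u} [TopologicalSpace X] [TopologicalSpace Y]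
    (f : C(X, Y)) {n : ℕ} {φ : Cochain Y R n} (hφ : φ ∈ locallyZero Y R n) :
    pullback R f n φ ∈ locallyZero X R n := by
  refine Set.eq_empty_of_forall_notMem ?_
  rintro _ ⟨⟨p, rfl⟩, hc⟩
  have hcont : Continuous (fun (x : Fin (n + 1) → X) (k : Fin (n + 1)) => f (x k)) := by
    fun_prop
  exact Set.eq_empty_iff_forall_notMem.1 hφ (fun _ => f p)
    ⟨⟨f p, rfl⟩, hcont.closure_preimage_subset _ hc⟩

variable (X R)

/-- Alexander–Spanier cochains `C^n(X;R) / C_0^n(X;R)`. -/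
abbrev ASCochain (n : ℕ) : Type (max u v) := Cochain X R n ⧸ locallyZero X R n

/-- The induced differential on Alexander–Spanier cochains. -/
def asD (n : ℕ) : ASCochain X R n →ₗ[R] ASCochain X R (n + 1) :=
  Submodule.mapQ _ _ (coboundary X R n) fun _ => coboundary_mem_locallyZero

/-- The coboundaries of the augmented complex `R → C^0/C_0^0 → C^1/C_0^1 → ⋯`. -/
def reducedASCoboundaries : (n : ℕ) → Submodule R (ASCochain X R n)
  | 0 => LinearMap.range ((locallyZero X R 0).mkQ ∘ₗ constCochain X R)
  | n + 1 => LinearMap.range (asD X R n)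

theorem reducedASCoboundaries_le_ker (n : ℕ) :
    reducedASCoboundaries X R n ≤ LinearMap.ker (asD X R n) := by
  cases n with
  | zero =>
    rintro _ ⟨r, rfl⟩
    refine (Submodule.Quotient.mk_eq_zero _).2 ?_
    have h : coboundary X R 0 (constCochain X R r) = 0 := by
      funext x
      simp [coboundary_apply, constCochain, Fin.sum_univ_two]
    rw [h]
    exact zero_mem _
  | succ n =>
    rintro _ ⟨φ, rfl⟩
    obtain ⟨φ, rfl⟩ := Submodule.mkQ_surjective _ φ
    refine (Submodule.Quotient.mk_eq_zero _).2 ?_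
    rw [coboundary_coboundary]
    exact zero_mem _

/-- The reduced Alexander–Spanier cohomology `H̃^n(X;R)`: the cohomology in degree `n ≥ 0` of the
augmented complex `R → C^0/C_0^0 → C^1/C_0^1 → ⋯`. -/
abbrev ReducedAS (n : ℕ) : Type (max u v) :=
  LinearMap.ker (asD X R n) ⧸
    (reducedASCoboundaries X R n).submoduleOf (LinearMap.ker (asD X R n))

instance (n : ℕ) : AddCommGroup (ReducedAS X R n) := Submodule.Quotient.addCommGroup _

instance (n : ℕ) : Module R (ReducedAS X R n) := Submodule.Quotient.module _

variable {X} {Y : Type u} [TopologicalSpace Y]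

/-- The map of Alexander–Spanier cochains induced by a continuous map. -/
def asPullback (f : C(X, Y)) (n : ℕ) : ASCochain Y R n →ₗ[R] ASCochain X R n :=
  Submodule.mapQ _ _ (pullback R f n) fun _ => pullback_mem_locallyZero f

theorem asD_asPullback (f : C(X, Y)) (n : ℕ) (φ : ASCochain Y R n) :
    asD X R n (asPullback R f n φ) = asPullback R f (n + 1) (asD Y R n φ) := by
  obtain ⟨φ, rfl⟩ := Submodule.mkQ_surjective _ φ
  rfl

theorem asPullback_mem_coboundaries (f : C(X, Y)) (n : ℕ) {φ : ASCochain Y R n}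
    (hφ : φ ∈ reducedASCoboundaries Y R n) :
    asPullback R f n φ ∈ reducedASCoboundaries X R n := by
  cases n with
  | zero =>
    obtain ⟨r, rfl⟩ := hφ
    exact ⟨r, rfl⟩
  | succ n =>
    obtain ⟨ψ, rfl⟩ := hφ
    exact ⟨asPullback R f n ψ, asD_asPullback R f n ψ⟩

/-- The map on cocycles induced by a continuous map. -/
def asPullbackCocycles (f : C(X, Y)) (n : ℕ) :
    LinearMap.ker (asD Y R n) →ₗ[R] LinearMap.ker (asD X R n) :=
  (asPullback R f n).restrict fun φ hφ => by
    rw [LinearMap.mem_ker] at hφ ⊢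
    rw [asD_asPullback, hφ, map_zero]

/-- The map `f^* : H̃^n(Y;R) → H̃^n(X;R)` induced by a continuous map `f : X → Y`. -/
def ReducedAS.map (f : C(X, Y)) (n : ℕ) : ReducedAS Y R n →ₗ[R] ReducedAS X R n :=
  Submodule.mapQ _ _ (asPullbackCocycles R f n) fun _ hφ =>
    asPullback_mem_coboundaries R f n hφ

end AlexanderSpanier

/-! ### Reduced Alexander–Spanier cohomology at infinity -/

section AtInfinity

variable {X : Type u} [MetricSpace X]

/-- The complement `X − N_r(b)`. -/
def outside (b : X) (r : ℝ≥0) : Set X := (Metric.closedBall b r)ᶜ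

/-- For `r ≤ s`, the inclusion `X − N_s(b) → X − N_r(b)`. -/
def outsideIncl (b : X) {r s : ℝ≥0} (h : r ≤ s) : C(outside b s, outside b r) where
  toFun := Set.inclusion
    (Set.compl_subset_compl.2 (Metric.closedBall_subset_closedBall (NNReal.coe_le_coe.2 h)))
  continuous_toFun := continuous_inclusion _

open Classical in
/-- `lim_r H̃^n(X − N_r(b);R)`: the direct limit over `r ∈ [0,∞)`, along the restriction maps. -/
abbrev ReducedASAtInfinity (R : Type v) [Ring R] (b : X) (n : ℕ) : Type (max u v) :=
  Module.DirectLimit (fun r : ℝ≥0 => ReducedAS (outside b r) R n)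
    fun _ _ h => ReducedAS.map R (outsideIncl b h) n

end AtInfinity

/-! ### Acyclicity -/

section Acyclic

variable (R : Type v) [Ring R]

/-- Singular homology `H_n(-;R)`. -/
abbrev singularHomology (n : ℕ) : TopCat.{u} ⥤ ModuleCat.{max u v} R :=
  (AlgebraicTopology.singularHomologyFunctor (ModuleCat.{max u v} R) n).obj
    (ModuleCat.of R (ULift.{u} R))

/-- The reduced singular homology `H̃_n(Y;R)`: the kernel of `H_n(Y;R) → H_n(pt;R)`. -/
def reducedHomology (n : ℕ) (Y : Type u) [TopologicalSpace Y] :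
    Submodule R ((singularHomology.{u, v} R n).obj (TopCat.of Y)) :=
  LinearMap.ker ((singularHomology.{u, v} R n).map
    (TopCat.ofHom (ContinuousMap.const Y PUnit.unit.{u + 1}))).hom

/-- The map `H̃_n(A;R) → H̃_n(B;R)` induced by an inclusion `A ⊆ B` is zero. -/
def TrivialInclusion {X : Type u} [TopologicalSpace X] {A B : Set X} (h : A ⊆ B) (n : ℕ) :
    Prop :=
  ∀ z ∈ reducedHomology.{u, v} R n A,
    ((singularHomology.{u, v} R n).map
      (TopCat.ofHom ⟨Set.inclusion h, continuous_inclusion h⟩)).hom z = 0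

/-- `Y` is locally acyclic: in each degree, each neighbourhood `U` of a point contains a
neighbourhood `V` of it such that `V → U` is zero on reduced singular homology. -/
def LocallyAcyclic (Y : Type u) [TopologicalSpace Y] : Prop :=
  ∀ (n : ℕ) (x : Y), ∀ U ∈ 𝓝 x, ∃ V ∈ 𝓝 x, ∃ h : V ⊆ U, TrivialInclusion.{u, v} R h n

variable (X : Type u) [MetricSpace X]

/-- The complement of some bounded subset is locally acyclic. -/
def LocallyAcyclicAtInfinity : Prop :=
  ∃ K : Set X, Bornology.IsBounded K ∧ LocallyAcyclic.{u, v} R (Kᶜ : Set X)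

/-- There are non-decreasing `μ, ρ : [0,∞) → [0,∞)` and a base point `b` such that, for each
non-empty set `B` of diameter `r` with `d(b,B) ≥ μ(r)`, the inclusion `B → N_{ρ(r)}(B)` is zero on
reduced singular homology. -/
def UniformlyAcyclicAtInfinity : Prop :=
  ∃ (μ ρ : ℝ≥0 → ℝ≥0) (b : X), Monotone μ ∧ Monotone ρ ∧
    ∀ (r : ℝ≥0) (B : Set X), B.Nonempty → Metric.ediam B = r → (μ r : ℝ) ≤ Metric.infDist b B →
      ∀ n : ℕ, TrivialInclusion.{u, v} R (Metric.self_subset_cthickening (δ := ρ r) B) n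

end Acyclic

end CoarseCohomology

end

/-! Call a cochain locally zero at infinity (`FarLocallyZero`) if, outside some ball, it vanishes on
all tuples sufficiently near the diagonal. The complex of all cochains on `X`, augmented by `R`, is
exact: coning from a point contracts it (`coboundary_coneCochain`). Modulo the cochains that are
locally zero at infinity, its reduced cohomology is the direct limit of the reduced
Alexander–Spanier groups. The connecting map thus identifies that limit in degree `n` with the
degree `n + 1` cohomology of the complex of cochains that are locally zero at infinity. Coarse
cochains form a subcomplex of the latter, and what remains is that this inclusion induces
isomorphisms in cohomology. Both halves of this come from `exists_sub_coboundary_mem_coarseCochain`: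
if `φ` is locally zero at infinity and `dφ` is coarse, then `φ` becomes coarse after subtracting
some `dψ` with `ψ` locally zero at infinity.

To find `ψ`, take an open cover by sets on which `φ` vanishes, together with one ball around `b`. A
tuple is filled by a singular chain (`tupleToSingular`), and this chain is subdivided until its
simplices are small for the cover (`singularToTuple`). The composite `T` is joined to the identity
by a cone homotopy `H`, with `∂Hx = x - Tx - H∂x` for far tuples of bounded diameter. Put `ψ = φ ∘
H`. Uniform acyclicity keeps `Hx` far away and of bounded size, so `0 = dφ(Hx) = φ(x) - φ(Tx) -
dψ(x)`; and `φ(Tx) = 0` because `Tx` is small. Hence `φ - dψ` is coarse. Local acyclicity makes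
fillings of small tuples small, so that `ψ` is again locally zero at infinity.

One and the same filling has to obey both the local and the coarse bound. It is therefore chosen
nearly optimal (`IsNearOptimalFilling`): up to an error of the diameter of the tuple, it stays as
close to the tuple as any filling does, and so inherits whichever bound is available. -/

noncomputable section

namespace CoarseCohomology

/-! ### Singular chains as finitely supported functions -/

section SingularChains

/-- The singular `n`-simplices of a space. -/
abbrev SingularSimplex (A : Type u) [TopologicalSpace A] (n : ℕ) : Type u :=
  C(stdSimplex ℝ (Fin (n + 1)), A)

/-- The `i`-th face inclusion of standard simplices. -/
def faceMap (n : ℕ) (i : Fin (n + 2)) :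
    C(stdSimplex ℝ (Fin (n + 1)), stdSimplex ℝ (Fin (n + 2))) :=
  ⟨stdSimplex.map i.succAbove, stdSimplex.continuous_map _⟩

variable (R : Type v) [Ring R]

/-- The boundary of singular chains with coefficients in `R`. -/
def singularBoundary (A : Type u) [TopologicalSpace A] (n : ℕ) :
    (SingularSimplex A (n + 1) →₀ R) →ₗ[R] (SingularSimplex A n →₀ R) :=
  ∑ i : Fin (n + 2), (-1 : ℤ) ^ (i : ℕ) •
    Finsupp.lmapDomain R R fun σ : SingularSimplex A (n + 1) => σ.comp (faceMap n i)

theorem singularBoundary_single {A : Type u} [TopologicalSpace A] {n : ℕ}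
    (σ : SingularSimplex A (n + 1)) (r : R) :
    singularBoundary R A n (Finsupp.single σ r) =
      ∑ i : Fin (n + 2), (-1 : ℤ) ^ (i : ℕ) • Finsupp.single (σ.comp (faceMap n i)) r := by
  simp [singularBoundary, LinearMap.sum_apply, Finsupp.mapDomain_single]

/-- The chain map induced by a continuous map. -/
def singularMap {A B : Type u} [TopologicalSpace A] [TopologicalSpace B] (f : C(A, B)) (n : ℕ) :
    (SingularSimplex A n →₀ R) →ₗ[R] (SingularSimplex B n →₀ R) :=
  Finsupp.lmapDomain R R fun σ : SingularSimplex A n => f.comp σ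

theorem singularMap_single {A B : Type u} [TopologicalSpace A] [TopologicalSpace B] (f : C(A, B))
    {n : ℕ} (σ : SingularSimplex A n) (r : R) :
    singularMap R f n (Finsupp.single σ r) = Finsupp.single (f.comp σ) r := by
  simp [singularMap, Finsupp.mapDomain_single]

theorem singularBoundary_singularMap {A B : Type u} [TopologicalSpace A] [TopologicalSpace B]
    (f : C(A, B)) (n : ℕ) (z : SingularSimplex A (n + 1) →₀ R) :
    singularBoundary R B n (singularMap R f (n + 1) z) =
      singularMap R f n (singularBoundary R A n z) := by
  induction z using Finsupp.induction_linear with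
  | zero => simp
  | add x y hx hy => simp only [map_add, hx, hy]
  | single σ r =>
    simp only [singularMap_single, singularBoundary_single, map_sum, map_zsmul,
      ContinuousMap.comp_assoc]

/-- Mathlib's singular chain complex. -/
abbrev mathlibChains (A : Type u) [TopologicalSpace A] :
    ChainComplex (ModuleCat.{max u v} R) ℕ :=
  (TopCat.toSSet.obj (TopCat.of A)).chainComplex (ModuleCat.of R (ULift.{u} R))

/-- The chain map of Mathlib's singular chain complexes induced by a continuous map. -/
abbrev mathlibMap {A B : Type u} [TopologicalSpace A] [TopologicalSpace B] (f : C(A, B)) :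
    mathlibChains.{u, v} R A ⟶ mathlibChains.{u, v} R B :=
  SSet.chainComplexMap (TopCat.toSSet.map (TopCat.ofHom f)) (ModuleCat.of R (ULift.{u} R))

variable {A : Type u} [TopologicalSpace A]

/-- Simplices of the singular simplicial set as continuous maps. -/
def simplexEquiv (A : Type u) [TopologicalSpace A] (n : ℕ) :
    (TopCat.toSSet.obj (TopCat.of A)).obj (Opposite.op (SimplexCategory.mk n)) ≃
      SingularSimplex A n :=
  TopCat.toSSetObjEquiv (TopCat.of A) (Opposite.op (SimplexCategory.mk n))

theorem simplexEquiv_δ {n : ℕ} (i : Fin (n + 2))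
    (x : (TopCat.toSSet.obj (TopCat.of A)).obj (Opposite.op (SimplexCategory.mk (n + 1)))) :
    simplexEquiv A n ((TopCat.toSSet.obj (TopCat.of A)).δ i x) =
      (simplexEquiv A (n + 1) x).comp (faceMap n i) := rfl

theorem simplexEquiv_map {B : Type u} [TopologicalSpace B] (f : C(A, B)) {n : ℕ}
    (x : (TopCat.toSSet.obj (TopCat.of A)).obj (Opposite.op (SimplexCategory.mk n))) :
    simplexEquiv B n ((TopCat.toSSet.map (TopCat.ofHom f)).app _ x) =
      f.comp (simplexEquiv A n x) := rfl

/-- The comparison of Mathlib's singular chains with finitely supported functions. -/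
def toFinsuppChains (A : Type u) [TopologicalSpace A] (n : ℕ) :
    (mathlibChains.{u, v} R A).X n ⟶ ModuleCat.of R (SingularSimplex A n →₀ R) :=
  Limits.Sigma.desc fun x => ModuleCat.ofHom
    (Finsupp.lsingle (simplexEquiv A n x) ∘ₗ ULift.moduleEquiv.toLinearMap)

theorem ι_toFinsuppChains {n : ℕ}
    (x : (TopCat.toSSet.obj (TopCat.of A)).obj (Opposite.op (SimplexCategory.mk n))) :
    SSet.ιChainComplex (R := ModuleCat.of R (ULift.{u} R)) _ x ≫ toFinsuppChains.{u, v} R A n =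
      ModuleCat.ofHom
        (Finsupp.lsingle (simplexEquiv A n x) ∘ₗ ULift.moduleEquiv.toLinearMap) :=
  Limits.Sigma.ι_desc _ _

theorem toFinsuppChains_ι {n : ℕ}
    (x : (TopCat.toSSet.obj (TopCat.of A)).obj (Opposite.op (SimplexCategory.mk n)))
    (r : ULift.{u} R) :
    (toFinsuppChains.{u, v} R A n).hom
        ((SSet.ιChainComplex (R := ModuleCat.of R (ULift.{u} R)) _ x).hom r) =
      Finsupp.single (simplexEquiv A n x) r.down := by
  have := congrArg (fun f => f.hom r) (ι_toFinsuppChains R x)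
  exact this

theorem toFinsuppChains_d (n : ℕ) :
    (mathlibChains.{u, v} R A).d (n + 1) n ≫ toFinsuppChains.{u, v} R A n =
      toFinsuppChains.{u, v} R A (n + 1) ≫ ModuleCat.ofHom (singularBoundary R A n) := by
  refine SSet.chainComplex_hom_ext fun x => ?_
  rw [SSet.ιChainComplex_d_assoc, ← Category.assoc, ι_toFinsuppChains]
  rw [Preadditive.sum_comp]
  simp only [Preadditive.zsmul_comp, ι_toFinsuppChains, simplexEquiv_δ]
  refine ModuleCat.hom_ext (LinearMap.ext fun r => ?_)
  simp [singularBoundary_single, ModuleCat.hom_sum, LinearMap.sum_apply]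

theorem toFinsuppChains_map {B : Type u} [TopologicalSpace B] (f : C(A, B)) (n : ℕ) :
    (mathlibMap.{u, v} R f).f n ≫ toFinsuppChains.{u, v} R B n =
      toFinsuppChains.{u, v} R A n ≫ ModuleCat.ofHom (singularMap R f n) := by
  refine SSet.chainComplex_hom_ext fun x => ?_
  rw [SSet.ι_chainComplexMap_f_assoc, ← Category.assoc, ι_toFinsuppChains, ι_toFinsuppChains]
  ext r
  simp [simplexEquiv_map, singularMap_single]

/-- The inverse of `toFinsuppChains`. -/
def ofFinsuppChains (A : Type u) [TopologicalSpace A] (n : ℕ) :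
    (SingularSimplex A n →₀ R) →ₗ[R] (mathlibChains.{u, v} R A).X n :=
  Finsupp.lsum ℕ fun σ =>
    (SSet.ιChainComplex (R := ModuleCat.of R (ULift.{u} R)) _ ((simplexEquiv A n).symm σ)).hom ∘ₗ
      ULift.moduleEquiv.symm.toLinearMap

theorem toFinsuppChains_ofFinsuppChains {n : ℕ} (z : SingularSimplex A n →₀ R) :
    (toFinsuppChains.{u, v} R A n).hom (ofFinsuppChains.{u, v} R A n z) = z := by
  induction z using Finsupp.induction_linear with
  | zero => simp
  | add x y hx hy => simp only [map_add, hx, hy]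
  | single σ r =>
    simp only [ofFinsuppChains, Finsupp.lsum_single]
    refine (toFinsuppChains_ι R ((simplexEquiv A n).symm σ) _).trans ?_
    simp

theorem ofFinsuppChains_toFinsuppChains (n : ℕ) :
    toFinsuppChains.{u, v} R A n ≫ ModuleCat.ofHom (ofFinsuppChains.{u, v} R A n) = 𝟙 _ := by
  refine SSet.chainComplex_hom_ext fun x => ?_
  rw [← Category.assoc, ι_toFinsuppChains]
  refine ModuleCat.hom_ext (LinearMap.ext fun r => ?_)
  have h := (ofFinsuppChains.{u, v} R A n).comp_apply
    (Finsupp.lsingle (simplexEquiv A n x) ∘ₗ ULift.moduleEquiv.toLinearMap) r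
  refine h.trans ?_
  simp only [ofFinsuppChains, LinearMap.comp_apply, Finsupp.lsingle_apply, Finsupp.lsum_single,
    Equiv.symm_apply_apply]
  rfl

theorem toFinsuppChains_injective (n : ℕ) :
    Function.Injective (toFinsuppChains.{u, v} R A n).hom :=
  Function.LeftInverse.injective (g := ofFinsuppChains.{u, v} R A n) fun x =>
    congrArg (fun f => f.hom x) (ofFinsuppChains_toFinsuppChains R n)

/-- Reduced cycles: chains of augmentation zero in degree zero, and cycles in positive degrees. -/
def IsReducedCycle : (n : ℕ) → (SingularSimplex A n →₀ R) → Prop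
  | 0, z => (z.sum fun _ r => r) = 0
  | n + 1, z => singularBoundary R A n z = 0

/-- A point has a single singular 0-simplex, so pushing a 0-chain to a point records its
augmentation. This matches the elementwise notion of reduced cycle with the kernel in
`reducedHomology`. -/
theorem singularMap_const_of_isReducedCycle {z : SingularSimplex A 0 →₀ R}
    (hz : IsReducedCycle R 0 z) :
    singularMap R (ContinuousMap.const A PUnit.unit.{u + 1}) 0 z = 0 := by
  have hsub (σ τ : SingularSimplex PUnit.{u + 1} 0) : σ = τ := by ext x
  have h (w : SingularSimplex A 0 →₀ R) :
      singularMap R (ContinuousMap.const A PUnit.unit.{u + 1}) 0 w =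
        Finsupp.single (ContinuousMap.const _ PUnit.unit) (w.sum fun _ r => r) := by
    induction w using Finsupp.induction_linear with
    | zero => simp
    | add x y hx hy =>
      rw [map_add, hx, hy, Finsupp.sum_add_index' (fun _ => rfl) (fun _ _ _ => rfl),
        Finsupp.single_add]
    | single σ r =>
      rw [singularMap_single, Finsupp.sum_single_index rfl]
      congr 1
  rw [h, show (z.sum fun _ r => r) = 0 from hz, Finsupp.single_zero]

theorem d_ofFinsuppChains {n : ℕ} {z : SingularSimplex A n →₀ R} (hz : IsReducedCycle R n z) :
    ((mathlibChains.{u, v} R A).d n ((ComplexShape.down ℕ).next n)).hom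
      (ofFinsuppChains.{u, v} R A n z) = 0 := by
  cases n with
  | zero =>
    rw [HomologicalComplex.shape _ _ _ (by simp)]
    rfl
  | succ n =>
    rw [ChainComplex.next_nat_succ]
    apply toFinsuppChains_injective
    have h := congrArg (fun f => f.hom (ofFinsuppChains.{u, v} R A (n + 1) z))
      (toFinsuppChains_d.{u, v} R (A := A) n)
    refine Eq.trans h ?_
    rw [map_zero]
    refine Eq.trans (congrArg (singularBoundary R A n) (toFinsuppChains_ofFinsuppChains R z)) hz

theorem exists_iCycles_eq {S : Type*} [Ring S] (K : ChainComplex (ModuleCat S) ℕ) (n : ℕ)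
    (x : K.X n) (hx : (K.d n ((ComplexShape.down ℕ).next n)).hom x = 0) :
    ∃ c : K.cycles n, (K.iCycles n).hom c = x := by
  refine ⟨(K.sc n).moduleCatCyclesIso.inv.hom ⟨x, hx⟩, ?_⟩
  exact congrArg (fun f => f.hom (⟨x, hx⟩ : LinearMap.ker (K.sc n).g.hom))
    (K.sc n).moduleCatCyclesIso_inv_iCycles

theorem exists_d_eq_of_homologyπ_eq_zero {S : Type*} [Ring S] (K : ChainComplex (ModuleCat S) ℕ)
    (n : ℕ) (c : K.cycles n) (hc : (K.homologyπ n).hom c = 0) :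
    ∃ w : K.X (n + 1), (K.d (n + 1) n).hom w = (K.iCycles n).hom c := by
  have h : (K.pOpcycles n).hom ((K.iCycles n).hom c) = 0 := by
    have := congrArg (fun f => f.hom c) (K.homology_π_ι n)
    refine this.symm.trans ?_
    refine (congrArg (K.homologyι n).hom hc).trans (map_zero _)
  obtain ⟨w, hw⟩ := ((K.sc n).moduleCat_pOpcycles_eq_zero_iff _).1 h
  have hn : (ComplexShape.down ℕ).prev n = n + 1 := by simp
  revert w
  change ∀ w : K.X ((ComplexShape.down ℕ).prev n), (K.d _ n).hom w = _ → _
  rw [hn]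
  exact fun w hw => ⟨w, hw⟩

/-- A reduced cycle whose homology class dies under `f` bounds after pushing it forward. -/
theorem exists_singularBoundary_eq {B : Type u} [TopologicalSpace B] (f : C(A, B)) (n : ℕ)
    (hf : ∀ z ∈ reducedHomology.{u, v} R n A,
      ((singularHomology.{u, v} R n).map (TopCat.ofHom f)).hom z = 0)
    {z : SingularSimplex A n →₀ R} (hz : IsReducedCycle R n z) :
    ∃ w, singularBoundary R B n w = singularMap R f n z := by
  obtain ⟨c, hc⟩ := exists_iCycles_eq (mathlibChains.{u, v} R A) n _ (d_ofFinsuppChains R hz)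
  have hcycles {D : Type u} [TopologicalSpace D] (g : C(A, D)) :
      ((mathlibChains.{u, v} R D).iCycles n).hom
        ((HomologicalComplex.cyclesMap (mathlibMap.{u, v} R g) n).hom c) =
        ((mathlibMap.{u, v} R g).f n).hom (ofFinsuppChains.{u, v} R A n z) := by
    rw [← hc]
    exact congrArg (fun f => f.hom c) (HomologicalComplex.cyclesMap_i (mathlibMap.{u, v} R g) n)
  have hpush {D : Type u} [TopologicalSpace D] (g : C(A, D)) :
      (toFinsuppChains.{u, v} R D n).hom
        (((mathlibMap.{u, v} R g).f n).hom (ofFinsuppChains.{u, v} R A n z)) =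
        singularMap R g n z := by
    refine (congrArg (fun f => f.hom (ofFinsuppChains.{u, v} R A n z))
      (toFinsuppChains_map.{u, v} R g n)).trans ?_
    exact congrArg (singularMap R g n) (toFinsuppChains_ofFinsuppChains R z)
  obtain ⟨a, hclass⟩ : ∃ a : (singularHomology.{u, v} R n).obj (TopCat.of A),
      ∀ {D : Type u} [TopologicalSpace D] (g : C(A, D)),
        ((mathlibChains.{u, v} R D).homologyπ n).hom
          ((HomologicalComplex.cyclesMap (mathlibMap.{u, v} R g) n).hom c) =
        ((singularHomology.{u, v} R n).map (TopCat.ofHom g)).hom a :=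
    ⟨((mathlibChains.{u, v} R A).homologyπ n).hom c, fun g => (congrArg (fun f => f.hom c)
      (HomologicalComplex.homologyπ_naturality (mathlibMap.{u, v} R g) n)).symm⟩
  have hred : a ∈ reducedHomology.{u, v} R n A := by
    refine LinearMap.mem_ker.2 ?_
    -- In degree zero the pushed cycle itself vanishes on the point; in positive degrees the
    -- homology of a point vanishes.
    cases n with
    | zero =>
      refine (hclass _).symm.trans ?_
      have h0 : (HomologicalComplex.cyclesMap
          (mathlibMap.{u, v} R (ContinuousMap.const A PUnit.unit.{u + 1})) 0).hom c = 0 := by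
        apply (ModuleCat.mono_iff_injective
          ((mathlibChains.{u, v} R PUnit.{u + 1}).iCycles 0)).1 inferInstance
        refine (hcycles _).trans (toFinsuppChains_injective R 0 ?_)
        rw [hpush, singularMap_const_of_isReducedCycle R hz]
        simp
      exact (congrArg _ h0).trans (map_zero _)
    | succ n =>
      have := AlgebraicTopology.isZero_singularHomologyFunctor_of_totallyDisconnectedSpace
        (ModuleCat.{max u v} R) (n + 1) (ModuleCat.of R (ULift.{u} R))
        (TopCat.of PUnit.{u + 1}) n.succ_ne_zero
      have hs := ModuleCat.subsingleton_of_isZero this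
      exact hs.elim _ _
  obtain ⟨w, hw⟩ := exists_d_eq_of_homologyπ_eq_zero (mathlibChains.{u, v} R B) n _
    ((hclass f).trans (hf _ hred))
  refine ⟨(toFinsuppChains.{u, v} R B (n + 1)).hom w, ?_⟩
  refine (congrArg (fun f => f.hom w) (toFinsuppChains_d.{u, v} R (A := B) n)).symm.trans ?_
  refine Eq.trans (congrArg (toFinsuppChains.{u, v} R B n).hom (hw.trans (hcycles f))) ?_
  exact hpush f

end SingularChains

/-! ### Chains supported in a subset, and acyclic inclusions seen inside an ambient space -/

section SupportedChains

variable (R : Type v) [Ring R]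

/-- A linear map sends chains supported on `s` into `Q` if it does so for the generators in `s`. -/
theorem map_mem_of_mem_supported {α M : Type*} [AddCommGroup M] [Module R M]
    (f : (α →₀ R) →ₗ[R] M) {s : Set α} {Q : Submodule R M}
    (h : ∀ a ∈ s, f (Finsupp.single a 1) ∈ Q) {z : α →₀ R} (hz : z ∈ Finsupp.supported R R s) :
    f z ∈ Q := by
  rw [Finsupp.supported_eq_span_single] at hz
  have : Submodule.span R ((fun i => Finsupp.single i (1 : R)) '' s) ≤ Q.comap f := by
    rw [Submodule.span_le]
    rintro _ ⟨a, ha, rfl⟩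
    exact h a ha
  exact this hz

variable {R} in
theorem linearMap_eq_of_mem_supported {α M : Type*} [AddCommGroup M] [Module R M]
    {f g : (α →₀ R) →ₗ[R] M} {s : Set α}
    (h : ∀ a ∈ s, f (Finsupp.single a 1) = g (Finsupp.single a 1)) {z : α →₀ R}
    (hz : z ∈ Finsupp.supported R R s) : f z = g z := by
  have := map_mem_of_mem_supported R (f - g) (Q := ⊥) (s := s)
    (fun a ha => by simp [h a ha]) hz
  simpa [sub_eq_zero] using this

/-- The singular chains of `X` in a subset. -/
def singularIn {X : Type u} [TopologicalSpace X] (S : Set X) (n : ℕ) :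
    Submodule R (SingularSimplex X n →₀ R) :=
  Finsupp.supported R R {σ | ∀ t, σ t ∈ S}

variable {R}

theorem singularIn_mono {X : Type u} [TopologicalSpace X] {S T : Set X} (h : S ⊆ T) (n : ℕ) :
    singularIn R S n ≤ singularIn R T n :=
  Finsupp.supported_mono fun _ hσ t => h (hσ t)

theorem singularMap_mem_singularIn {A X : Type u} [TopologicalSpace A] [TopologicalSpace X]
    (f : C(A, X)) {n : ℕ} (z : SingularSimplex A n →₀ R) :
    singularMap R f n z ∈ singularIn R (Set.range f) n := by
  refine map_mem_of_mem_supported R (singularMap R f n) (s := Set.univ) (fun σ _ => ?_)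
    (by simp)
  rw [singularMap_single]
  exact Finsupp.single_mem_supported R _ fun t => ⟨σ t, rfl⟩

theorem exists_singularMap_eq {A X : Type u} [TopologicalSpace A] [TopologicalSpace X]
    {f : C(A, X)} (hf : Topology.IsEmbedding f) {n : ℕ} {z : SingularSimplex X n →₀ R}
    (hz : z ∈ singularIn R (Set.range f) n) : ∃ z', singularMap R f n z' = z := by
  refine map_mem_of_mem_supported R LinearMap.id (Q := LinearMap.range (singularMap R f n))
    (fun σ hσ => ?_) hz
  let τ : SingularSimplex A n :=
    ⟨fun t => hf.toHomeomorph.symm ⟨σ t, hσ t⟩, by fun_prop⟩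
  refine ⟨Finsupp.single τ 1, ?_⟩
  rw [singularMap_single]
  congr 1
  ext t
  exact congrArg Subtype.val (hf.toHomeomorph.apply_symm_apply ⟨σ t, hσ t⟩)

theorem singularMap_injective {A X : Type u} [TopologicalSpace A] [TopologicalSpace X]
    {f : C(A, X)} (hf : Function.Injective f) (n : ℕ) :
    Function.Injective (singularMap R f n) :=
  Finsupp.mapDomain_injective fun σ τ h => by
    ext t
    exact hf (DFunLike.congr_fun h t)

theorem isReducedCycle_of_singularMap {A X : Type u} [TopologicalSpace A] [TopologicalSpace X]
    {f : C(A, X)} (hf : Function.Injective f) {n : ℕ} {z : SingularSimplex A n →₀ R}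
    (hz : IsReducedCycle R n (singularMap R f n z)) : IsReducedCycle R n z := by
  cases n with
  | zero =>
    refine Eq.trans ?_ (show _ = (0 : R) from hz)
    exact (Finsupp.sum_mapDomain_index (h := fun _ r => r) (fun _ => rfl)
      fun _ _ _ => rfl).symm
  | succ n =>
    apply singularMap_injective hf n
    rw [map_zero, ← singularBoundary_singularMap]
    exact hz

/-- Acyclicity of `A ⊆ B` in a space embedded in `X`, in terms of chains of `X`. -/
theorem exists_filling_of_trivialInclusion {Z X : Type u} [TopologicalSpace Z]
    [TopologicalSpace X] {e : C(Z, X)} (he : Topology.IsEmbedding e) {A B : Set Z} {h : A ⊆ B} {n : ℕ}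
    (htriv : TrivialInclusion.{u, v} R h n) {z : SingularSimplex X n →₀ R}
    (hz : z ∈ singularIn R (e '' A) n) (hc : IsReducedCycle R n z) :
    ∃ w ∈ singularIn R (e '' B) (n + 1), singularBoundary R X n w = z := by
  have hemb (S : Set Z) : Topology.IsEmbedding
      (e.comp (⟨Subtype.val, continuous_subtype_val⟩ : C(S, Z))) :=
    he.comp Topology.IsEmbedding.subtypeVal
  have hrange (S : Set Z) :
      Set.range (e.comp (⟨Subtype.val, continuous_subtype_val⟩ : C(S, Z))) = e '' S := by
    ext x
    simp
  rw [← hrange] at hz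
  obtain ⟨z, rfl⟩ := exists_singularMap_eq (hemb A) hz
  obtain ⟨w, hw⟩ := exists_singularBoundary_eq R
    (⟨Set.inclusion h, continuous_inclusion h⟩ : C(A, B)) n htriv
    (isReducedCycle_of_singularMap (hemb A).injective hc)
  refine ⟨singularMap R (e.comp ⟨Subtype.val, continuous_subtype_val⟩) (n + 1) w, ?_, ?_⟩
  · rw [← hrange]
    exact singularMap_mem_singularIn _ _
  · rw [singularBoundary_singularMap, hw]
    simp only [singularMap, Finsupp.lmapDomain_apply, ← Finsupp.mapDomain_comp]
    rfl

/-- Inherited from `d ∘ d = 0` in the categorical chain complex, through the comparison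
`toFinsuppChains`. -/
theorem singularBoundary_singularBoundary {A : Type u} [TopologicalSpace A] (n : ℕ)
    (z : SingularSimplex A (n + 2) →₀ R) :
    singularBoundary R A n (singularBoundary R A (n + 1) z) = 0 := by
  have h1 := congrArg (fun f => f.hom (ofFinsuppChains.{u, v} R A (n + 2) z))
    (toFinsuppChains_d.{u, v} R (A := A) (n + 1))
  have h2 := congrArg (fun f => f.hom (((mathlibChains.{u, v} R A).d (n + 2) (n + 1)).hom
    (ofFinsuppChains.{u, v} R A (n + 2) z))) (toFinsuppChains_d.{u, v} R (A := A) n)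
  have h3 := congrArg (fun f => f.hom (ofFinsuppChains.{u, v} R A (n + 2) z))
    ((mathlibChains.{u, v} R A).d_comp_d (n + 2) (n + 1) n)
  have h4 := toFinsuppChains_ofFinsuppChains.{u, v} R z
  refine Eq.trans (congrArg (singularBoundary R A n) ?_)
    (h2.symm.trans ((congrArg (toFinsuppChains.{u, v} R A n).hom h3).trans (map_zero _)))
  exact Eq.trans (congrArg (singularBoundary R A (n + 1)) h4.symm) h1.symm

end SupportedChains

/-! ### Tuple chains, their duality with cochains, and cones -/

section TupleChains

variable (R : Type v) [Ring R]

/-- Formal linear combinations of `(n+1)`-tuples. -/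
abbrev TupleChain (E : Type*) (n : ℕ) := (Fin (n + 1) → E) →₀ R

/-- The boundary of tuple chains. -/
def tupleBoundary (E : Type*) (n : ℕ) : TupleChain R E (n + 1) →ₗ[R] TupleChain R E n :=
  Finsupp.linearCombination R fun x =>
    ∑ i : Fin (n + 2), (-1 : ℤ) ^ (i : ℕ) • Finsupp.single (fun k => x (i.succAbove k)) (1 : R)

/-- The augmentation of tuple chains. -/
def tupleAugmentation (E : Type*) : TupleChain R E 0 →ₗ[R] R :=
  Finsupp.linearCombination R fun _ => 1

/-- The map of tuple chains induced by a function. -/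
def tupleMap {E F : Type*} (f : E → F) (n : ℕ) : TupleChain R E n →ₗ[R] TupleChain R F n :=
  Finsupp.linearCombination R fun x => Finsupp.single (fun k => f (x k)) 1

/-- The cone with apex `p`. -/
def tupleCone {E : Type*} (p : E) (n : ℕ) : TupleChain R E n →ₗ[R] TupleChain R E (n + 1) :=
  Finsupp.linearCombination R fun x => Finsupp.single (Fin.cons p x) 1

variable {R} {E : Type*} {F : Type*}

@[simp]
theorem tupleBoundary_single {n : ℕ} (x : Fin (n + 2) → E) :
    tupleBoundary R E n (Finsupp.single x 1) =
      ∑ i : Fin (n + 2), (-1 : ℤ) ^ (i : ℕ) •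
        Finsupp.single (fun k => x (i.succAbove k)) (1 : R) := by
  simp [tupleBoundary]

@[simp]
theorem tupleMap_single (f : E → F) {n : ℕ} (x : Fin (n + 1) → E) :
    tupleMap R f n (Finsupp.single x 1) = Finsupp.single (fun k => f (x k)) 1 := by
  simp [tupleMap]

@[simp]
theorem tupleCone_single (p : E) {n : ℕ} (x : Fin (n + 1) → E) :
    tupleCone R p n (Finsupp.single x 1) = Finsupp.single (Fin.cons p x) 1 := by
  simp [tupleCone]

theorem linearMap_ext_single {α M : Type*} [AddCommGroup M] [Module R M]
    {f g : (α →₀ R) →ₗ[R] M} (h : ∀ a, f (Finsupp.single a 1) = g (Finsupp.single a 1)) :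
    f = g :=
  LinearMap.ext fun _ => linearMap_eq_of_mem_supported (s := Set.univ) (fun a _ => h a) (by simp)

/-- Evaluation of cochains on chains turns the boundary into the coboundary. -/
theorem linearCombination_tupleBoundary {n : ℕ} (φ : Cochain E R n) (z : TupleChain R E (n + 1)) :
    Finsupp.linearCombination R φ (tupleBoundary R E n z) =
      Finsupp.linearCombination R (coboundary E R n φ) z := by
  rw [← LinearMap.comp_apply]
  congr 1
  refine linearMap_ext_single fun x => ?_
  simp [coboundary_apply, map_sum]

/-- Dual to `coboundary_coboundary`: each coefficient is read off by evaluating the indicator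
cochain of a tuple. -/
theorem tupleBoundary_tupleBoundary {n : ℕ} (z : TupleChain R E (n + 2)) :
    tupleBoundary R E n (tupleBoundary R E (n + 1) z) = 0 := by
  classical
  ext t
  have h := linearCombination_tupleBoundary (R := R) (Pi.single t 1)
    (tupleBoundary R E (n + 1) z)
  rw [linearCombination_tupleBoundary (coboundary E R n _), coboundary_coboundary] at h
  have h0 : Finsupp.linearCombination R (0 : Cochain E R (n + 2)) z = 0 := by
    simp
  rw [h0] at h
  rw [Finsupp.zero_apply, ← h, Finsupp.linearCombination_apply, Finsupp.sum_eq_single t]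
  · simp
  · intro b _ hb
    simp [hb]
  · simp

theorem tupleAugmentation_tupleBoundary (z : TupleChain R E 1) :
    tupleAugmentation R E (tupleBoundary R E 0 z) = 0 := by
  change (tupleAugmentation R E ∘ₗ tupleBoundary R E 0) z = (0 : TupleChain R E 1 →ₗ[R] R) z
  congr 1
  refine linearMap_ext_single fun x => ?_
  simp [tupleAugmentation, Fin.sum_univ_two]

theorem tupleBoundary_tupleMap (f : E → F) {n : ℕ} (z : TupleChain R E (n + 1)) :
    tupleBoundary R F n (tupleMap R f (n + 1) z) = tupleMap R f n (tupleBoundary R E n z) := by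
  rw [← LinearMap.comp_apply, ← LinearMap.comp_apply]
  congr 1
  refine linearMap_ext_single fun x => ?_
  simp only [LinearMap.comp_apply, tupleMap_single, tupleBoundary_single, map_sum, map_zsmul]

theorem tupleAugmentation_tupleMap (f : E → F) (z : TupleChain R E 0) :
    tupleAugmentation R F (tupleMap R f 0 z) = tupleAugmentation R E z := by
  rw [← LinearMap.comp_apply]
  congr 1
  refine linearMap_ext_single fun x => ?_
  simp [tupleAugmentation]

theorem tupleMap_tupleMap {G : Type*} (f : E → F) (g : F → G) {n : ℕ} (z : TupleChain R E n) :
    tupleMap R g n (tupleMap R f n z) = tupleMap R (fun x => g (f x)) n z := by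
  rw [← LinearMap.comp_apply]
  congr 1
  refine linearMap_ext_single fun x => ?_
  simp

/-- Reduced cycles of tuple chains. -/
def IsReducedTupleCycle : (n : ℕ) → TupleChain R E n → Prop
  | 0, z => tupleAugmentation R E z = 0
  | n + 1, z => tupleBoundary R E n z = 0

theorem isReducedTupleCycle_tupleBoundary {n : ℕ} (z : TupleChain R E (n + 1)) :
    IsReducedTupleCycle n (tupleBoundary R E n z) := by
  cases n with
  | zero => exact tupleAugmentation_tupleBoundary z
  | succ n => exact tupleBoundary_tupleBoundary z

/-- The face opposite the apex is the original tuple; the other faces are the cones on its faces,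
with shifted sign. -/
theorem tupleBoundary_tupleCone (p : E) {n : ℕ} (z : TupleChain R E (n + 1)) :
    tupleBoundary R E (n + 1) (tupleCone R p (n + 1) z) =
      z - tupleCone R p n (tupleBoundary R E n z) := by
  change (tupleBoundary R E (n + 1) ∘ₗ tupleCone R p (n + 1)) z =
    (LinearMap.id - (tupleCone R p n) ∘ₗ tupleBoundary R E n : _ →ₗ[R] _) z
  congr 1
  refine linearMap_ext_single fun x => ?_
  simp only [LinearMap.comp_apply, tupleCone_single, tupleBoundary_single, LinearMap.sub_apply,
    LinearMap.id_apply, map_sum, map_zsmul]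
  rw [Fin.sum_univ_succ, sub_eq_add_neg, ← Finset.sum_neg_distrib]
  congr 1
  · simp
  · refine Finset.sum_congr rfl fun i _ => ?_
    rw [Fin.val_succ, pow_succ, mul_neg_one, neg_smul]
    congr 3
    funext k
    refine Fin.cases ?_ (fun k => ?_) k <;> simp

theorem tupleBoundary_tupleCone_zero (p : E) (z : TupleChain R E 0) :
    tupleBoundary R E 0 (tupleCone R p 0 z) =
      z - tupleAugmentation R E z • Finsupp.single (fun _ => p) 1 := by
  change (tupleBoundary R E 0 ∘ₗ tupleCone R p 0) z =
    (LinearMap.id - (tupleAugmentation R E).smulRight (Finsupp.single (fun _ => p) 1) : _ →ₗ[R] _) z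
  congr 1
  refine linearMap_ext_single fun x => ?_
  simp only [LinearMap.comp_apply, tupleCone_single, tupleBoundary_single, LinearMap.sub_apply,
    LinearMap.id_apply, LinearMap.smulRight_apply, tupleAugmentation,
    Finsupp.linearCombination_single, smul_eq_mul, mul_one, one_smul]
  refine (Fin.sum_univ_two _).trans ?_
  simp only [Fin.val_zero, pow_zero, one_smul, Fin.val_one, pow_one, neg_smul, ← sub_eq_add_neg]
  congr 3
  funext k
  have : k = 0 := Fin.ext (by omega)
  subst this
  rfl

theorem tupleBoundary_tupleCone_of_isReducedTupleCycle (p : E) {n : ℕ} {z : TupleChain R E n}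
    (hz : IsReducedTupleCycle n z) : tupleBoundary R E n (tupleCone R p n z) = z := by
  cases n with
  | zero =>
    rw [tupleBoundary_tupleCone_zero, show tupleAugmentation R E z = 0 from hz, zero_smul, sub_zero]
  | succ n =>
    rw [tupleBoundary_tupleCone, show tupleBoundary R E n z = 0 from hz, map_zero, sub_zero]

end TupleChains

/-! ### Barycentric subdivision of affine simplices -/

section Barycentric

variable (R : Type v) [Ring R] {E : Type*} [NormedAddCommGroup E] [NormedSpace ℝ E]

/-- The barycenter of a tuple. -/
def barycenter {n : ℕ} (v : Fin (n + 1) → E) : E := ((n : ℝ) + 1)⁻¹ • ∑ i, v i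

theorem barycenter_mem_convexHull {n : ℕ} (v : Fin (n + 1) → E) :
    barycenter v ∈ convexHull ℝ (Set.range v) := by
  rw [barycenter, Finset.smul_sum]
  refine (convex_convexHull ℝ _).sum_mem (fun _ _ => by positivity) ?_
    fun i _ => subset_convexHull ℝ _ ⟨i, rfl⟩
  simp only [Finset.sum_const, Finset.card_univ, Fintype.card_fin, nsmul_eq_mul, Nat.cast_add,
    Nat.cast_one]
  field_simp

/-- The difference is an average of `n + 1` vectors `v j - v i`, and the one with `j = i` is zero;
this gives the contraction factor. -/
theorem dist_barycenter_le {n : ℕ} {v : Fin (n + 1) → E} {d : ℝ}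
    (hv : ∀ i j, dist (v i) (v j) ≤ d) (i : Fin (n + 1)) :
    dist (barycenter v) (v i) ≤ n / (n + 1) * d := by
  have h : barycenter v - v i = ((n : ℝ) + 1)⁻¹ • ∑ j, (v j - v i) := by
    rw [Finset.sum_sub_distrib, smul_sub, ← barycenter]
    congr 1
    simp only [Finset.sum_const, Finset.card_univ, Fintype.card_fin, ← Nat.cast_smul_eq_nsmul ℝ,
      smul_smul]
    rw [Nat.cast_add, Nat.cast_one, inv_mul_cancel₀ (by positivity), one_smul]
  rw [dist_eq_norm, h, norm_smul, Real.norm_of_nonneg (by positivity), div_mul_eq_mul_div,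
    div_eq_inv_mul]
  refine mul_le_mul_of_nonneg_left ?_ (by positivity)
  rw [Fin.sum_univ_succAbove _ i, sub_self, zero_add]
  refine (norm_sum_le_of_le _ fun j _ => (dist_eq_norm (v _) (v i)).symm.le.trans (hv _ _)).trans ?_
  simp

theorem dist_barycenter_le_of_mem_convexHull {n : ℕ} {v : Fin (n + 1) → E} {d : ℝ}
    (hv : ∀ i j, dist (v i) (v j) ≤ d) {p : E} (hp : p ∈ convexHull ℝ (Set.range v)) :
    dist (barycenter v) p ≤ n / (n + 1) * d := by
  have h : convexHull ℝ (Set.range v) ⊆ Metric.closedBall (barycenter v) (n / (n + 1) * d) := by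
    refine convexHull_min ?_ (convex_closedBall _ _)
    rintro _ ⟨i, rfl⟩
    rw [Metric.mem_closedBall']
    exact dist_barycenter_le hv i
  exact Metric.mem_closedBall'.1 (h hp)

/-- The barycentric subdivision of an affine simplex. -/
def subdivideTuple : (n : ℕ) → (Fin (n + 1) → E) → TupleChain R E n
  | 0, v => Finsupp.single v 1
  | n + 1, v => tupleCone R (barycenter v) n (Finsupp.linearCombination R (subdivideTuple n)
      (tupleBoundary R E n (Finsupp.single v 1)))

/-- Barycentric subdivision. -/
def subdivide (n : ℕ) : TupleChain R E n →ₗ[R] TupleChain R E n :=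
  Finsupp.linearCombination R (subdivideTuple R n)

/-- The homotopy between an affine simplex and its barycentric subdivision. -/
def subdivideHomotopyTuple : (n : ℕ) → (Fin (n + 1) → E) → TupleChain R E (n + 1)
  | 0, _ => 0
  | n + 1, v => tupleCone R (barycenter v) (n + 1) (Finsupp.single v 1 -
      Finsupp.linearCombination R (subdivideHomotopyTuple n)
        (tupleBoundary R E n (Finsupp.single v 1)))

/-- The homotopy between the identity and barycentric subdivision. -/
def subdivideHomotopy (n : ℕ) : TupleChain R E n →ₗ[R] TupleChain R E (n + 1) :=
  Finsupp.linearCombination R (subdivideHomotopyTuple R n)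

variable {R}

theorem subdivide_zero (z : TupleChain R E 0) : subdivide R 0 z = z := by
  change subdivide R 0 z = LinearMap.id (R := R) z
  congr 1
  exact linearMap_ext_single fun v => by simp [subdivide, subdivideTuple]

theorem subdivide_succ_single {n : ℕ} (v : Fin (n + 2) → E) :
    subdivide R (n + 1) (Finsupp.single v 1) =
      tupleCone R (barycenter v) n (subdivide R n (tupleBoundary R E n (Finsupp.single v 1))) := by
  simp only [subdivide, Finsupp.linearCombination_single, one_smul, subdivideTuple]

theorem subdivideHomotopy_zero (z : TupleChain R E 0) : subdivideHomotopy R 0 z = 0 := by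
  change subdivideHomotopy R 0 z = (0 : _ →ₗ[R] _) z
  congr 1
  exact linearMap_ext_single fun v => by simp [subdivideHomotopy, subdivideHomotopyTuple]

theorem subdivideHomotopy_succ_single {n : ℕ} (v : Fin (n + 2) → E) :
    subdivideHomotopy R (n + 1) (Finsupp.single v 1) =
      tupleCone R (barycenter v) (n + 1) (Finsupp.single v 1 -
        subdivideHomotopy R n (tupleBoundary R E n (Finsupp.single v 1))) := by
  simp only [subdivideHomotopy, Finsupp.linearCombination_single, one_smul,
    subdivideHomotopyTuple]

theorem tupleBoundary_subdivide {n : ℕ} (z : TupleChain R E (n + 1)) :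
    tupleBoundary R E n (subdivide R (n + 1) z) = subdivide R n (tupleBoundary R E n z) := by
  rw [← LinearMap.comp_apply, ← LinearMap.comp_apply]
  congr 1
  refine linearMap_ext_single fun v => ?_
  rw [LinearMap.comp_apply, LinearMap.comp_apply, subdivide_succ_single]
  refine tupleBoundary_tupleCone_of_isReducedTupleCycle _ ?_
  cases n with
  | zero => rw [subdivide_zero]; exact isReducedTupleCycle_tupleBoundary _
  | succ n =>
    change tupleBoundary R E n _ = 0
    rw [tupleBoundary_subdivide, tupleBoundary_tupleBoundary, map_zero]

theorem tupleBoundary_subdivideHomotopy {n : ℕ} (z : TupleChain R E (n + 1)) :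
    tupleBoundary R E (n + 1) (subdivideHomotopy R (n + 1) z) =
      z - subdivide R (n + 1) z - subdivideHomotopy R n (tupleBoundary R E n z) := by
  change (tupleBoundary R E (n + 1) ∘ₗ subdivideHomotopy R (n + 1)) z =
    (LinearMap.id - subdivide R (n + 1) - subdivideHomotopy R n ∘ₗ tupleBoundary R E n :
      _ →ₗ[R] _) z
  congr 1
  refine linearMap_ext_single fun v => ?_
  simp only [LinearMap.comp_apply, LinearMap.sub_apply, LinearMap.id_apply]
  rw [subdivideHomotopy_succ_single, tupleBoundary_tupleCone, subdivide_succ_single, map_sub]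
  have h : tupleBoundary R E n (subdivideHomotopy R n (tupleBoundary R E n (Finsupp.single v 1))) =
      tupleBoundary R E n (Finsupp.single v 1) -
        subdivide R n (tupleBoundary R E n (Finsupp.single v 1)) := by
    cases n with
    | zero => rw [subdivideHomotopy_zero, subdivide_zero, map_zero, sub_self]
    | succ n =>
      rw [tupleBoundary_subdivideHomotopy, tupleBoundary_tupleBoundary, map_zero, sub_zero]
  rw [h, sub_sub_cancel]
  abel

/-- Chains on tuples in a set. -/
def tuplesIn {E : Type*} (S : Set E) (n : ℕ) : Set (Fin (n + 1) → E) := {x | ∀ i, x i ∈ S}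

theorem tupleCone_mem_supported {E : Type*} {n : ℕ} {p : E} {s : Set (Fin (n + 1) → E)}
    {t : Set (Fin (n + 2) → E)} (h : ∀ x ∈ s, Fin.cons p x ∈ t) {z : TupleChain R E n}
    (hz : z ∈ Finsupp.supported R R s) : tupleCone R p n z ∈ Finsupp.supported R R t := by
  refine map_mem_of_mem_supported R _ (fun x hx => ?_) hz
  rw [tupleCone_single]
  exact Finsupp.single_mem_supported R _ (h x hx)

theorem cons_mem_tuplesIn {E : Type*} {S : Set E} {n : ℕ} {p : E} (hp : p ∈ S)
    {x : Fin (n + 1) → E} (hx : x ∈ tuplesIn S n) :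
    (Fin.cons p x : Fin (n + 2) → E) ∈ tuplesIn S (n + 1) :=
  fun i => Fin.cases hp hx i

theorem convexHull_face_subset {n : ℕ} (v : Fin (n + 2) → E) (i : Fin (n + 2)) :
    convexHull ℝ (Set.range fun k => v (i.succAbove k)) ⊆ convexHull ℝ (Set.range v) :=
  convexHull_mono (by rintro _ ⟨k, rfl⟩; exact ⟨_, rfl⟩)

/-- Edges at the new apex are bounded by its distance to points of the hull. The remaining edges
come from subdivided faces, whose smaller factor `n / (n + 1)` is dominated by the next one. -/
theorem subdivide_single_mem {n : ℕ} {v : Fin (n + 1) → E} {d : ℝ}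
    (hv : ∀ i j, dist (v i) (v j) ≤ d) :
    subdivide R n (Finsupp.single v 1) ∈ Finsupp.supported R R
      {t | t ∈ tuplesIn (convexHull ℝ (Set.range v)) n ∧
        ∀ i j, dist (t i) (t j) ≤ n / (n + 1) * d} := by
  induction n generalizing d with
  | zero =>
    rw [subdivide_zero]
    refine Finsupp.single_mem_supported R _ ⟨fun i => subset_convexHull ℝ _ ⟨i, rfl⟩, fun i j => ?_⟩
    obtain rfl : i = j := Fin.ext (by omega)
    simp
  | succ n ih =>
    have hd : 0 ≤ d := dist_nonneg.trans (hv 0 0)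
    rw [subdivide_succ_single]
    refine tupleCone_mem_supported (s := {t | t ∈ tuplesIn (convexHull ℝ (Set.range v)) n ∧
        ∀ i j, dist (t i) (t j) ≤ n / (n + 1) * d}) ?_ ?_
    · rintro x ⟨hx, hx'⟩
      have hb := fun i => dist_barycenter_le_of_mem_convexHull hv (hx i)
      have hle : (n : ℝ) / (n + 1) * d ≤ (n + 1 : ℕ) / ((n + 1 : ℕ) + 1) * d := by
        refine mul_le_mul_of_nonneg_right ?_ hd
        rw [div_le_div_iff₀ (by positivity) (by positivity)]
        push_cast
        nlinarith
      refine ⟨cons_mem_tuplesIn (barycenter_mem_convexHull v) hx, fun i j => ?_⟩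
      refine Fin.cases ?_ (fun i => ?_) i <;> refine Fin.cases ?_ (fun j => ?_) j
      · simp only [dist_self]
        positivity
      · simpa using hb j
      · rw [dist_comm]
        simpa using hb i
      · simpa using (hx' i j).trans hle
    · rw [tupleBoundary_single, map_sum]
      refine Submodule.sum_mem _ fun i _ => ?_
      rw [map_zsmul]
      refine zsmul_mem (Finsupp.supported_mono ?_ (ih fun _ _ => hv _ _)) _
      exact fun t ht => ⟨fun k => convexHull_face_subset v i (ht.1 k), ht.2⟩

theorem subdivideHomotopy_single_mem {n : ℕ} (v : Fin (n + 1) → E) :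
    subdivideHomotopy R n (Finsupp.single v 1) ∈ Finsupp.supported R R
      (tuplesIn (convexHull ℝ (Set.range v)) (n + 1)) := by
  induction n with
  | zero =>
    rw [subdivideHomotopy_zero]
    exact zero_mem _
  | succ n ih =>
    rw [subdivideHomotopy_succ_single]
    refine tupleCone_mem_supported
      (fun x hx => cons_mem_tuplesIn (barycenter_mem_convexHull v) hx) (sub_mem ?_ ?_)
    · exact Finsupp.single_mem_supported R _ fun i => subset_convexHull ℝ _ ⟨i, rfl⟩
    · rw [tupleBoundary_single, map_sum]
      refine Submodule.sum_mem _ fun i _ => ?_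
      rw [map_zsmul]
      refine zsmul_mem (Finsupp.supported_mono ?_ (ih fun k => v (i.succAbove k))) _
      exact fun t ht k => convexHull_face_subset v i (ht k)

/-- Tuples in `K` whose convex hull lies in a member of `𝒜`. -/
def smallTuples (K : Set E) (𝒜 : Set (Set E)) (n : ℕ) : Set (Fin (n + 1) → E) :=
  {t | t ∈ tuplesIn K n ∧ ∃ A ∈ 𝒜, convexHull ℝ (Set.range t) ⊆ A}

/-- Tuples in `K` of diameter at most `d`. -/
def meshTuples (K : Set E) (d : ℝ) (n : ℕ) : Set (Fin (n + 1) → E) :=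
  {t | t ∈ tuplesIn K n ∧ ∀ i j, dist (t i) (t j) ≤ d}

theorem tuplesIn_convexHull_subset_smallTuples {K : Set E} (hK : Convex ℝ K) {𝒜 : Set (Set E)}
    {m n : ℕ} {v : Fin (m + 1) → E} (hv : v ∈ smallTuples K 𝒜 m) :
    tuplesIn (convexHull ℝ (Set.range v)) n ⊆ smallTuples K 𝒜 n := by
  obtain ⟨hvK, A, hA, hvA⟩ := hv
  have h : convexHull ℝ (Set.range v) ⊆ K :=
    convexHull_min (by rintro _ ⟨i, rfl⟩; exact hvK i) hK
  refine fun t ht => ⟨fun i => h (ht i), A, hA, ?_⟩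
  exact (convexHull_min (by rintro _ ⟨i, rfl⟩; exact ht i) (convex_convexHull ℝ _)).trans hvA

/-- Subdividing `w` also subdivides its boundary; adding the homotopy applied to `z` restores it.
Small simplices remain small because subdivision and homotopy stay in convex hulls, while the others
shrink. -/
theorem exists_finer_filling {K : Set E} (hK : Convex ℝ K) {𝒜 : Set (Set E)} {n : ℕ}
    {z : TupleChain R E n} (hz : IsReducedTupleCycle n z)
    (hzs : z ∈ Finsupp.supported R R (smallTuples K 𝒜 n)) {d : ℝ} {w : TupleChain R E (n + 1)}
    (hw : w ∈ Finsupp.supported R R (smallTuples K 𝒜 (n + 1) ∪ meshTuples K d (n + 1)))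
    (hwz : tupleBoundary R E n w = z) :
    ∃ w' ∈ Finsupp.supported R R (smallTuples K 𝒜 (n + 1) ∪
        meshTuples K ((n + 1 : ℕ) / ((n + 1 : ℕ) + 1) * d) (n + 1)),
      tupleBoundary R E n w' = z := by
  refine ⟨subdivide R (n + 1) w + subdivideHomotopy R n z, add_mem ?_ ?_, ?_⟩
  · refine map_mem_of_mem_supported R _ (fun v hv => ?_) hw
    rcases hv with hv | hv
    -- For a tuple that is already small only the location of its subdivision matters, so any bound
    -- `e` on its diameter serves.
    · obtain ⟨e, he⟩ := (Set.finite_range fun p : Fin (n + 2) × Fin (n + 2) =>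
        dist (v p.1) (v p.2)).bddAbove
      refine Finsupp.supported_mono ?_
        (subdivide_single_mem (R := R) (d := e) fun i j => he ⟨(i, j), rfl⟩)
      exact fun t ht => Or.inl (tuplesIn_convexHull_subset_smallTuples hK hv ht.1)
    · refine Finsupp.supported_mono ?_ (subdivide_single_mem (R := R) hv.2)
      refine fun t ht => Or.inr ⟨fun i => ?_, ht.2⟩
      exact convexHull_min (by rintro _ ⟨i, rfl⟩; exact hv.1 i) hK (ht.1 i)
  · refine map_mem_of_mem_supported R _ (fun v hv => ?_) hzs
    refine Finsupp.supported_mono ?_ (subdivideHomotopy_single_mem v)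
    exact fun t ht => Or.inl (tuplesIn_convexHull_subset_smallTuples hK hv ht)
  · rw [map_add, tupleBoundary_subdivide, hwz]
    cases n with
    | zero => rw [subdivide_zero, subdivideHomotopy_zero, map_zero, add_zero]
    | succ n =>
      rw [tupleBoundary_subdivideHomotopy, show tupleBoundary R E n z = 0 from hz, map_zero]
      abel

/-- A small cycle in a bounded convex set bounds a small chain. -/
theorem exists_small_filling {K : Set E} (hK : Convex ℝ K) (hne : K.Nonempty)
    (hb : Bornology.IsBounded K) {𝒜 : Set (Set E)} {ε : ℝ} (hε : 0 < ε)
    (h𝒜 : ∀ p ∈ K, ∃ A ∈ 𝒜, Metric.closedBall p ε ∩ K ⊆ A) {n : ℕ} {z : TupleChain R E n}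
    (hz : IsReducedTupleCycle n z) (hzs : z ∈ Finsupp.supported R R (smallTuples K 𝒜 n)) :
    ∃ w ∈ Finsupp.supported R R (smallTuples K 𝒜 (n + 1)), tupleBoundary R E n w = z := by
  obtain ⟨p, hp⟩ := hne
  obtain ⟨d, hd⟩ := Metric.isBounded_iff.1 hb
  -- The contraction factor for the `(n + 1)`-simplices of a filling. Starting from a cone with mesh
  -- at most `d`, iterated subdivision brings the mesh below `ε`.
  set θ : ℝ := (n + 1 : ℕ) / ((n + 1 : ℕ) + 1) with hθ
  have hθ0 : 0 ≤ θ := by positivity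
  have hθ1 : θ < 1 := by
    rw [hθ, div_lt_one (by positivity)]
    linarith
  have key (m : ℕ) : ∃ w ∈ Finsupp.supported R R (smallTuples K 𝒜 (n + 1) ∪
        meshTuples K (θ ^ m * d) (n + 1)), tupleBoundary R E n w = z := by
    induction m with
    | zero =>
      refine ⟨tupleCone R p n z, tupleCone_mem_supported (fun x hx => Or.inr ?_) hzs,
        tupleBoundary_tupleCone_of_isReducedTupleCycle p hz⟩
      have := cons_mem_tuplesIn hp hx.1
      exact ⟨this, fun i j => by simpa using hd (this i) (this j)⟩
    | succ m ih =>
      obtain ⟨w, hw, hwz⟩ := ih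
      obtain ⟨w', hw', hwz'⟩ := exists_finer_filling hK hz hzs hw hwz
      refine ⟨w', ?_, hwz'⟩
      rwa [pow_succ', mul_assoc]
  have hlim : Filter.Tendsto (fun m : ℕ => θ ^ m * d) Filter.atTop (𝓝 0) := by
    simpa using (tendsto_pow_atTop_nhds_zero_of_lt_one hθ0 hθ1).mul_const d
  obtain ⟨m, hm⟩ := (hlim.eventually (gt_mem_nhds hε)).exists
  obtain ⟨w, hw, hwz⟩ := key m
  refine ⟨w, Finsupp.supported_mono (Set.union_subset subset_rfl ?_) hw, hwz⟩
  rintro t ⟨htK, ht⟩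
  obtain ⟨A, hA, hA'⟩ := h𝒜 (t 0) (htK 0)
  refine ⟨htK, A, hA, (convexHull_min ?_ ((convex_closedBall (t 0) ε).inter hK)).trans hA'⟩
  rintro _ ⟨i, rfl⟩
  exact ⟨(ht i 0).trans hm.le, htK i⟩

end Barycentric

/-! ### Subdividing singular simplices subordinate to an open cover -/

section SmallSimplices

variable (R : Type v) [Ring R]

theorem tupleMap_injective {E F : Type*} [Nonempty E] {f : E → F} (hf : Function.Injective f)
    (n : ℕ) : Function.Injective (tupleMap R f n) := by
  refine Function.LeftInverse.injective (g := tupleMap R (Function.invFun f) n) fun z => ?_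
  rw [tupleMap_tupleMap]
  change tupleMap R _ n z = LinearMap.id (R := R) z
  congr 1
  exact linearMap_ext_single fun x => by simp [Function.leftInverse_invFun hf _]

/-- The standard simplex. -/
abbrev StdSimplex (k : ℕ) : Type := stdSimplex ℝ (Fin (k + 1))

variable {X : Type u} [TopologicalSpace X]

/-- Tuples of points of a standard simplex whose convex hull is sent into a member of `𝒰`. -/
def smallIn (𝒰 : Set (Set X)) {k : ℕ} (σ : SingularSimplex X k) (n : ℕ) :
    Set (Fin (n + 1) → StdSimplex k) :=
  {t | ∃ U ∈ 𝒰, ∀ p : StdSimplex k,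
    (p : Fin (k + 1) → ℝ) ∈ convexHull ℝ (Set.range fun i => (t i : Fin (k + 1) → ℝ)) → σ p ∈ U}

variable {R}

theorem isReducedTupleCycle_tupleMap {E F : Type*} (f : E → F) {n : ℕ} {z : TupleChain R E n}
    (hz : IsReducedTupleCycle n z) : IsReducedTupleCycle n (tupleMap R f n z) := by
  cases n with
  | zero => exact (tupleAugmentation_tupleMap f z).trans hz
  | succ n =>
    change tupleBoundary R F n _ = 0
    rw [tupleBoundary_tupleMap, show tupleBoundary R E n z = 0 from hz, map_zero]

/-- A Lebesgue number for the pulled-back cover of the compact simplex reduces this to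
`exists_small_filling` in the ambient vector space; convexity keeps the filling in the simplex. -/
theorem exists_smallIn_filling {𝒰 : Set (Set X)} (hopen : ∀ U ∈ 𝒰, IsOpen U)
    (hcover : ∀ x : X, ∃ U ∈ 𝒰, x ∈ U) {k : ℕ} (σ : SingularSimplex X k) {n : ℕ}
    {z : TupleChain R (StdSimplex k) n} (hz : IsReducedTupleCycle n z)
    (hzs : z ∈ Finsupp.supported R R (smallIn 𝒰 σ n)) :
    ∃ w ∈ Finsupp.supported R R (smallIn 𝒰 σ (n + 1)),
      tupleBoundary R (StdSimplex k) n w = z := by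
  set K : Set (Fin (k + 1) → ℝ) := stdSimplex ℝ (Fin (k + 1))
  have hKc : IsCompact K := isCompact_stdSimplex ℝ _
  have hK : Convex ℝ K := convex_stdSimplex ℝ _
  have hsmall {m : ℕ} (t : Fin (m + 1) → StdSimplex k) (ht : t ∈ smallIn 𝒰 σ m) :
      (fun i => (t i : Fin (k + 1) → ℝ)) ∈
        smallTuples K {A | ∃ U ∈ 𝒰, A = Subtype.val '' (σ ⁻¹' U)} m := by
    obtain ⟨U, hU, h⟩ := ht
    refine ⟨fun i => (t i).2, _, ⟨U, hU, rfl⟩, fun p hp => ?_⟩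
    have hpK : p ∈ K := convexHull_min (by rintro _ ⟨i, rfl⟩; exact (t i).2) hK hp
    exact ⟨⟨p, hpK⟩, h ⟨p, hpK⟩ hp, rfl⟩
  have : CompactSpace (StdSimplex k) := isCompact_iff_compactSpace.1 hKc
  obtain ⟨δ, hδ, hball⟩ := lebesgue_number_lemma_of_metric (s := (Set.univ : Set (StdSimplex k)))
    (c := fun U : 𝒰 => σ ⁻¹' (U : Set X)) isCompact_univ
    (fun U => (hopen U U.2).preimage σ.continuous)
    (fun p _ => by
      obtain ⟨U, hU, h⟩ := hcover (σ p)
      exact Set.mem_iUnion.2 ⟨⟨U, hU⟩, h⟩)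
  obtain ⟨w, hw, hwz⟩ := exists_small_filling (R := R) (K := K)
    (𝒜 := {A | ∃ U ∈ 𝒰, A = Subtype.val '' (σ ⁻¹' U)}) hK
    (Set.nonempty_coe_sort.1 (inferInstance : Nonempty (StdSimplex k))) hKc.isBounded
    (half_pos hδ) (fun p hp => by
      obtain ⟨U, hU⟩ := hball ⟨p, hp⟩ trivial
      refine ⟨_, ⟨U, U.2, rfl⟩, fun q hq => ⟨⟨q, hq.2⟩, hU ?_, rfl⟩⟩
      exact lt_of_le_of_lt (Metric.mem_closedBall.1 hq.1) (half_lt_self hδ))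
    (isReducedTupleCycle_tupleMap Subtype.val hz)
    (map_mem_of_mem_supported R _ (fun t ht => by
      rw [tupleMap_single]
      exact Finsupp.single_mem_supported R _ (hsmall t ht)) hzs)
  have hlift : w ∈ (Finsupp.supported R R (smallIn 𝒰 σ (n + 1))).map
      (tupleMap R (Subtype.val : StdSimplex k → _) (n + 1)) := by
    refine map_mem_of_mem_supported R LinearMap.id (fun t ht => ?_) hw
    obtain ⟨htK, _, ⟨U, hU, rfl⟩, h⟩ := ht
    refine ⟨Finsupp.single (fun i => ⟨t i, htK i⟩) 1, Finsupp.single_mem_supported R _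
      ⟨U, hU, fun p hp => ?_⟩, tupleMap_single _ _⟩
    obtain ⟨q, hq, hqp⟩ := h hp
    rwa [← Subtype.ext hqp]
  obtain ⟨w, hws, rfl⟩ := hlift
  refine ⟨w, hws, tupleMap_injective R Subtype.val_injective n ?_⟩
  rw [← tupleBoundary_tupleMap, hwz]

variable (R)

open Classical in
/-- A subdivision of a singular simplex into tuples that are small for the cover `𝒰`. -/
def smallSubdivision (𝒰 : Set (Set X)) :
    (k : ℕ) → SingularSimplex X k → TupleChain R (StdSimplex k) k
  | 0, _ => Finsupp.single (fun _ => default) 1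
  | k + 1, σ =>
    -- For an open cover the condition always holds, by `smallSubdivision_spec`; the value `0` is
    -- then never taken.
    if h : ∃ w ∈ Finsupp.supported R R (smallIn 𝒰 σ (k + 1)),
        tupleBoundary R (StdSimplex (k + 1)) k w = ∑ i : Fin (k + 2), (-1 : ℤ) ^ (i : ℕ) •
          tupleMap R (faceMap k i) k (smallSubdivision 𝒰 k (σ.comp (faceMap k i)))
    then h.choose else 0

/-- The subdivision of the simplices of a standard simplex, pushed forward to it. -/
def pushSubdivision (𝒰 : Set (Set X)) {k : ℕ} (σ : SingularSimplex X k) (j : ℕ) :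
    (SingularSimplex (StdSimplex k) j →₀ R) →ₗ[R] TupleChain R (StdSimplex k) j :=
  Finsupp.linearCombination R fun τ => tupleMap R τ j (smallSubdivision R 𝒰 j (σ.comp τ))

variable {R}

theorem sum_smallSubdivision_eq (𝒰 : Set (Set X)) {k : ℕ} (σ : SingularSimplex X (k + 1)) :
    ∑ i : Fin (k + 2), (-1 : ℤ) ^ (i : ℕ) •
      tupleMap R (faceMap k i) k (smallSubdivision R 𝒰 k (σ.comp (faceMap k i))) =
    pushSubdivision R 𝒰 σ k (singularBoundary R (StdSimplex (k + 1)) k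
      (Finsupp.single (ContinuousMap.id _) 1)) := by
  rw [singularBoundary_single, map_sum]
  refine Finset.sum_congr rfl fun i _ => ?_
  rw [map_zsmul]
  simp [pushSubdivision]

/-- A face inclusion is the restriction of a linear map, hence commutes with convex hulls. -/
theorem smallIn_comp_faceMap {𝒰 : Set (Set X)} {k : ℕ} {σ : SingularSimplex X (k + 1)}
    {i : Fin (k + 2)} {n : ℕ} {t : Fin (n + 1) → StdSimplex k}
    (ht : t ∈ smallIn 𝒰 (σ.comp (faceMap k i)) n) :
    (fun j => faceMap k i (t j)) ∈ smallIn 𝒰 σ n := by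
  obtain ⟨U, hU, h⟩ := ht
  refine ⟨U, hU, fun p hp => ?_⟩
  have hrange : (Set.range fun j => (faceMap k i (t j) : Fin (k + 2) → ℝ)) =
      FunOnFinite.linearMap ℝ ℝ i.succAbove '' Set.range fun j => (t j : Fin (k + 1) → ℝ) := by
    rw [← Set.range_comp]
    rfl
  rw [hrange, ← LinearMap.image_convexHull] at hp
  obtain ⟨q, hq, hqp⟩ := hp
  have hqK : q ∈ stdSimplex ℝ (Fin (k + 1)) :=
    convexHull_min (by rintro _ ⟨j, rfl⟩; exact (t j).2) (convex_stdSimplex ℝ _) hq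
  have hp' : p = faceMap k i ⟨q, hqK⟩ := Subtype.ext hqp.symm
  rw [hp']
  exact h ⟨q, hqK⟩ hq

/-- An acyclic-models argument: the subdivisions of the faces assemble to a reduced cycle, which
bounds by `exists_smallIn_filling`. Both clauses go through one induction, since existence in degree
`k + 1` is what makes the chosen value there meaningful. -/
theorem smallSubdivision_spec {𝒰 : Set (Set X)} (hopen : ∀ U ∈ 𝒰, IsOpen U)
    (hcover : ∀ x : X, ∃ U ∈ 𝒰, x ∈ U) (k : ℕ) :
    (∀ σ : SingularSimplex X k,
      smallSubdivision R 𝒰 k σ ∈ Finsupp.supported R R (smallIn 𝒰 σ k)) ∧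
    ∀ σ : SingularSimplex X (k + 1), ∃ w ∈ Finsupp.supported R R (smallIn 𝒰 σ (k + 1)),
        tupleBoundary R (StdSimplex (k + 1)) k w = ∑ i : Fin (k + 2), (-1 : ℤ) ^ (i : ℕ) •
          tupleMap R (faceMap k i) k (smallSubdivision R 𝒰 k (σ.comp (faceMap k i))) := by
  have hsupp {k : ℕ} (hk : ∀ σ : SingularSimplex X k,
      smallSubdivision R 𝒰 k σ ∈ Finsupp.supported R R (smallIn 𝒰 σ k))
      (σ : SingularSimplex X (k + 1)) : ∑ i : Fin (k + 2), (-1 : ℤ) ^ (i : ℕ) •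
        tupleMap R (faceMap k i) k (smallSubdivision R 𝒰 k (σ.comp (faceMap k i))) ∈
        Finsupp.supported R R (smallIn 𝒰 σ k) := by
    refine Submodule.sum_mem _ fun i _ => zsmul_mem ?_ _
    refine map_mem_of_mem_supported R _ (fun t ht => ?_) (hk _)
    rw [tupleMap_single]
    exact Finsupp.single_mem_supported R _ (smallIn_comp_faceMap ht)
  induction k with
  | zero =>
    have h0 (σ : SingularSimplex X 0) :
        smallSubdivision R 𝒰 0 σ ∈ Finsupp.supported R R (smallIn 𝒰 σ 0) := by
      obtain ⟨U, hU, h⟩ := hcover (σ default)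
      refine Finsupp.single_mem_supported R _ ⟨U, hU, fun p _ => ?_⟩
      rwa [Subsingleton.elim p default]
    refine ⟨h0, fun σ => exists_smallIn_filling hopen hcover σ ?_ (hsupp h0 σ)⟩
    change tupleAugmentation R _ _ = 0
    rw [map_sum]
    simp only [map_zsmul, smallSubdivision, tupleAugmentation]
    simp
  | succ k ih =>
    have hspec (σ : SingularSimplex X (k + 1)) :
        smallSubdivision R 𝒰 (k + 1) σ = (ih.2 σ).choose := by
      rw [smallSubdivision, dif_pos (ih.2 σ)]
    have h0 (σ : SingularSimplex X (k + 1)) :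
        smallSubdivision R 𝒰 (k + 1) σ ∈ Finsupp.supported R R (smallIn 𝒰 σ (k + 1)) := by
      rw [hspec]
      exact (ih.2 σ).choose_spec.1
    refine ⟨h0, fun σ => exists_smallIn_filling hopen hcover σ ?_ (hsupp h0 σ)⟩
    change tupleBoundary R _ k _ = 0
    -- The assembled chain is the image of `∂(id)` under subdivision; as subdivision is a chain map
    -- in this degree, its boundary is the image of `∂∂(id) = 0`.
    have hchain (z : SingularSimplex (StdSimplex (k + 2)) (k + 1) →₀ R) :
        tupleBoundary R _ k (pushSubdivision R 𝒰 σ (k + 1) z) =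
          pushSubdivision R 𝒰 σ k (singularBoundary R _ k z) := by
      rw [← LinearMap.comp_apply, ← LinearMap.comp_apply]
      congr 1
      refine linearMap_ext_single fun τ => ?_
      rw [LinearMap.comp_apply, LinearMap.comp_apply, singularBoundary_single, map_sum]
      simp only [map_zsmul, pushSubdivision, Finsupp.linearCombination_single, one_smul]
      rw [tupleBoundary_tupleMap, hspec, (ih.2 _).choose_spec.2, map_sum]
      refine Finset.sum_congr rfl fun i _ => ?_
      rw [map_zsmul, tupleMap_tupleMap]
      rfl
    rw [sum_smallSubdivision_eq, hchain, singularBoundary_singularBoundary, map_zero]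

variable (R) in
/-- The chain map from singular chains to tuple chains that are small for the cover `𝒰`. -/
def singularToTuple (𝒰 : Set (Set X)) (k : ℕ) :
    (SingularSimplex X k →₀ R) →ₗ[R] TupleChain R X k :=
  Finsupp.linearCombination R fun σ => tupleMap R σ k (smallSubdivision R 𝒰 k σ)

theorem singularToTuple_zero_single (𝒰 : Set (Set X)) (σ : SingularSimplex X 0) :
    singularToTuple R 𝒰 0 (Finsupp.single σ 1) = Finsupp.single (fun _ => σ default) 1 := by
  simp [singularToTuple, smallSubdivision]

theorem tupleBoundary_singularToTuple {𝒰 : Set (Set X)} (hopen : ∀ U ∈ 𝒰, IsOpen U)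
    (hcover : ∀ x : X, ∃ U ∈ 𝒰, x ∈ U) {k : ℕ} (z : SingularSimplex X (k + 1) →₀ R) :
    tupleBoundary R X k (singularToTuple R 𝒰 (k + 1) z) =
      singularToTuple R 𝒰 k (singularBoundary R X k z) := by
  rw [← LinearMap.comp_apply, ← LinearMap.comp_apply]
  congr 1
  refine linearMap_ext_single fun σ => ?_
  rw [LinearMap.comp_apply, LinearMap.comp_apply, singularBoundary_single, map_sum]
  simp only [map_zsmul, singularToTuple, Finsupp.linearCombination_single, one_smul]
  have h := (smallSubdivision_spec (R := R) hopen hcover k).2 σ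
  rw [tupleBoundary_tupleMap, smallSubdivision, dif_pos h, h.choose_spec.2, map_sum]
  refine Finset.sum_congr rfl fun i _ => ?_
  rw [map_zsmul, tupleMap_tupleMap]
  rfl

theorem singularToTuple_mem {𝒰 : Set (Set X)} (hopen : ∀ U ∈ 𝒰, IsOpen U)
    (hcover : ∀ x : X, ∃ U ∈ 𝒰, x ∈ U) {k : ℕ} {S : Set X} {z : SingularSimplex X k →₀ R}
    (hz : z ∈ singularIn R S k) :
    singularToTuple R 𝒰 k z ∈ Finsupp.supported R R
      (tuplesIn S k ∩ {t | ∃ U ∈ 𝒰, t ∈ tuplesIn U k}) := by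
  refine map_mem_of_mem_supported R _ (fun σ hσ => ?_) hz
  simp only [singularToTuple, Finsupp.linearCombination_single, one_smul]
  refine map_mem_of_mem_supported R _ (fun t ht => ?_)
    ((smallSubdivision_spec (R := R) hopen hcover k).1 σ)
  rw [tupleMap_single]
  obtain ⟨U, hU, h⟩ := ht
  exact Finsupp.single_mem_supported R _
    ⟨fun i => hσ _, U, hU, fun i => h _ (subset_convexHull ℝ _ ⟨i, rfl⟩)⟩

end SmallSimplices

/-! ### Filling tuples by singular chains with local and coarse control -/

section TupleToSingular

variable (R : Type v) [Ring R] {X : Type u} [MetricSpace X]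

/-- Reduced cycles in `A` bound in `B`. -/
def FillsIn (A B : Set X) (n : ℕ) : Prop :=
  ∀ z ∈ singularIn R A n, IsReducedCycle R n z →
    ∃ w ∈ singularIn R B (n + 1), singularBoundary R X n w = z

variable {R}

theorem FillsIn.mono {A A' B B' : Set X} {n : ℕ} (h : FillsIn R A B n) (hA : A' ⊆ A)
    (hB : B ⊆ B') : FillsIn R A' B' n := fun z hz hc => by
  obtain ⟨w, hw, hwz⟩ := h z (singularIn_mono hA n hz) hc
  exact ⟨w, singularIn_mono hB _ hw, hwz⟩

/-- The ball may have diameter less than `2 * q`, so the hypothesis is applied at its true diameter;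
monotonicity of `μ` and `ρ` makes the constants depend on `q` alone. -/
theorem UniformlyAcyclicAtInfinity.exists_fillsIn_closedBall
    (h : UniformlyAcyclicAtInfinity.{u, v} R X) (b : X) {q : ℝ} (hq : 0 ≤ q) :
    ∃ M P : ℝ, 0 ≤ P ∧ ∀ x : X, M ≤ dist x b → ∀ n,
      FillsIn R (Metric.closedBall x q) (Metric.closedBall x P) n := by
  obtain ⟨μ, ρ, b₀, hμ, hρ, h⟩ := h
  set s : ℝ≥0 := ⟨2 * q, by positivity⟩
  refine ⟨μ s + q + dist b b₀, q + (ρ s + 1), by positivity, fun x hx n => ?_⟩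
  set B := Metric.closedBall x q
  have hBne : B.Nonempty := ⟨x, Metric.mem_closedBall_self hq⟩
  have hBs : Metric.ediam B ≤ s := by
    refine Metric.ediam_le fun y hy z hz => ?_
    rw [edist_dist, ← ENNReal.ofReal_coe_nnreal]
    refine ENNReal.ofReal_le_ofReal ?_
    change _ ≤ 2 * q
    linarith [dist_triangle_right y z x, Metric.mem_closedBall.1 hy, Metric.mem_closedBall.1 hz]
  have hBd : Metric.ediam B = (Metric.ediam B).toNNReal :=
    (ENNReal.coe_toNNReal (ne_top_of_le_ne_top ENNReal.coe_ne_top hBs)).symm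
  have hBs' : (Metric.ediam B).toNNReal ≤ s := by
    rw [hBd] at hBs
    exact_mod_cast hBs
  have hfar : (μ (Metric.ediam B).toNNReal : ℝ) ≤ Metric.infDist b₀ B := by
    refine (NNReal.coe_le_coe.2 (hμ hBs')).trans ((Metric.le_infDist hBne).2 fun y hy => ?_)
    have h1 := dist_triangle4 x y b₀ b
    have h2 := Metric.mem_closedBall'.1 hy
    rw [dist_comm b₀ b] at h1
    rw [dist_comm b₀ y]
    linarith
  intro z hz hc
  have hz' : z ∈ singularIn R ((ContinuousMap.id X) '' B) n := by simpa using hz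
  obtain ⟨w, hw, hwz⟩ := exists_filling_of_trivialInclusion (e := ContinuousMap.id X)
    Topology.IsEmbedding.id (h _ B hBne hBd hfar n) hz' hc
  refine ⟨w, singularIn_mono ?_ _ hw, hwz⟩
  rintro _ ⟨y, hy, rfl⟩
  -- A point of the closed thickening need not be within `ρ s` of an actual point of the ball; the
  -- extra `1` in the radius pays for this.
  have hy' := Metric.cthickening_subset_thickening' (show (0 : ℝ) < ρ s + 1 by positivity)
    (lt_of_le_of_lt (NNReal.coe_le_coe.2 (hρ hBs')) (lt_add_one _)) _ hy
  obtain ⟨y', hyB, hyy'⟩ := Metric.mem_thickening_iff.1 hy'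
  refine Metric.mem_closedBall.2 ((dist_triangle y y' x).trans ?_)
  linarith [Metric.mem_closedBall.1 hyB]

/-- Points beyond a ball containing the bounded set are interior to its complement, so
neighbourhoods in the complement are neighbourhoods in `X`. -/
theorem LocallyAcyclicAtInfinity.exists_fillsIn_nhds
    (h : LocallyAcyclicAtInfinity.{u, v} R X) (b : X) :
    ∃ L : ℝ, ∀ x : X, L < dist x b → ∀ n, ∀ U ∈ 𝓝 x, ∃ V ∈ 𝓝 x, FillsIn R V U n := by
  obtain ⟨K, hK, h⟩ := h
  obtain ⟨L, hL⟩ := (Metric.isBounded_iff_subset_closedBall b).1 hK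
  refine ⟨L, fun x hx n U hU => ?_⟩
  have hKx : Kᶜ ∈ 𝓝 x := by
    refine Filter.mem_of_superset (Metric.isClosed_closedBall.isOpen_compl.mem_nhds ?_)
      (Set.compl_subset_compl.2 hL)
    simpa using hx
  let x' : (Kᶜ : Set X) := ⟨x, mem_of_mem_nhds hKx⟩
  obtain ⟨V, hV, hVU, htriv⟩ := h n x' (Subtype.val ⁻¹' U)
    (continuous_subtype_val.continuousAt.preimage_mem_nhds hU)
  have hfill := fun (z : SingularSimplex X n →₀ R) => exists_filling_of_trivialInclusion
    (e := (⟨Subtype.val, continuous_subtype_val⟩ : C((Kᶜ : Set X), X)))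
    Topology.IsEmbedding.subtypeVal htriv (z := z)
  refine ⟨Subtype.val '' V, ?_, FillsIn.mono (fun z => hfill z) subset_rfl ?_⟩
  · rw [← map_nhds_subtype_coe_eq_nhds (mem_of_mem_nhds hKx) hKx]
    exact Filter.image_mem_map hV
  · rintro _ ⟨y, hy, rfl⟩
    exact hy

/-- `w` fills `z`, and it is up to `δ` as close to `p` as any filling of `z`. -/
def IsNearOptimalFilling {n : ℕ} (z : SingularSimplex X n →₀ R) (p : X) (δ : ℝ)
    (w : SingularSimplex X (n + 1) →₀ R) : Prop :=
  singularBoundary R X n w = z ∧ ∀ ρ : ℝ, 0 ≤ ρ →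
    (∃ w' ∈ singularIn R (Metric.closedBall p ρ) (n + 1), singularBoundary R X n w' = z) →
    w ∈ singularIn R (Metric.closedBall p (ρ + δ)) (n + 1)

/-- The infimum of the admissible radii need not be attained; a positive `δ` leaves room for a
filling whose radius is within `δ` of it. -/
theorem exists_isNearOptimalFilling {n : ℕ} {z : SingularSimplex X n →₀ R} {p : X} {δ : ℝ}
    (hδ : 0 < δ) {ρ : ℝ} (hρ : 0 ≤ ρ)
    (hz : ∃ w ∈ singularIn R (Metric.closedBall p ρ) (n + 1), singularBoundary R X n w = z) :
    ∃ w, IsNearOptimalFilling z p δ w := by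
  set S : Set ℝ := {ρ | 0 ≤ ρ ∧
    ∃ w ∈ singularIn R (Metric.closedBall p ρ) (n + 1), singularBoundary R X n w = z}
  have hS : BddBelow S := ⟨0, fun _ h => h.1⟩
  obtain ⟨ρ₁, ⟨-, w, hw, hwz⟩, hlt⟩ := Real.lt_sInf_add_pos (s := S) ⟨ρ, hρ, hz⟩ hδ
  refine ⟨w, hwz, fun ρ' h0 h' => singularIn_mono (Metric.closedBall_subset_closedBall ?_) _ hw⟩
  linarith [csInf_le hS (show ρ' ∈ S from ⟨h0, h'⟩)]

variable (R)

open Classical in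
/-- A singular chain that fills a tuple of points. -/
def tupleFilling : (k : ℕ) → (Fin (k + 1) → X) → (SingularSimplex X k →₀ R)
  | 0, x => Finsupp.single (ContinuousMap.const _ (x 0)) 1
  | k + 1, x =>
    -- A constant tuple has diameter zero and so leaves no slack for a near-optimal choice. It gets
    -- the filling `0`, which is consistent because its boundary is filled by `0` as well.
    if h : (∃ i, x i ≠ x 0) ∧ ∃ w, IsNearOptimalFilling
        (Finsupp.linearCombination R (tupleFilling k) (tupleBoundary R X k (Finsupp.single x 1)))
        (x 0) (Metric.diam (Set.range x)) w
    then h.2.choose else 0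

/-- The linear extension of `tupleFilling`. -/
def tupleToSingular (k : ℕ) : TupleChain R X k →ₗ[R] (SingularSimplex X k →₀ R) :=
  Finsupp.linearCombination R (tupleFilling R k)

/-- The boundary of the filling of a tuple is the filling of its boundary. -/
def IsFilled : (k : ℕ) → (Fin (k + 1) → X) → Prop
  | 0, _ => True
  | k + 1, x => singularBoundary R X k (tupleFilling R (k + 1) x) =
      tupleToSingular R k (tupleBoundary R X k (Finsupp.single x 1))

variable {R}

@[simp]
theorem tupleToSingular_single {k : ℕ} (x : Fin (k + 1) → X) :
    tupleToSingular R k (Finsupp.single x 1) = tupleFilling R k x := by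
  simp [tupleToSingular]

theorem tupleFilling_of_forall_eq {k : ℕ} {x : Fin (k + 2) → X} (hx : ∀ i, x i = x 0) :
    tupleFilling R (k + 1) x = 0 := by
  rw [tupleFilling, dif_neg]
  rintro ⟨⟨i, hi⟩, -⟩
  exact hi (hx i)

/-- For an edge the two equal endpoints cancel; in higher degrees every face is itself constant and
filled by `0`. -/
theorem tupleToSingular_tupleBoundary_of_forall_eq {k : ℕ} {x : Fin (k + 2) → X}
    (hx : ∀ i, x i = x 0) :
    tupleToSingular R k (tupleBoundary R X k (Finsupp.single x 1)) = 0 := by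
  rw [tupleBoundary_single, map_sum]
  simp only [map_zsmul, tupleToSingular_single]
  cases k with
  | zero =>
    rw [Fin.sum_univ_two]
    simp [tupleFilling, hx 1]
  | succ k =>
    refine Finset.sum_eq_zero fun i _ => ?_
    rw [tupleFilling_of_forall_eq fun j => (hx _).trans (hx _).symm, smul_zero]

theorem isReducedCycle_tupleToSingular {k : ℕ} {x : Fin (k + 2) → X}
    (hx : ∀ i : Fin (k + 2), IsFilled R k fun j => x (i.succAbove j)) :
    IsReducedCycle R k (tupleToSingular R k (tupleBoundary R X k (Finsupp.single x 1))) := by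
  cases k with
  | zero =>
    rw [tupleBoundary_single, map_sum]
    simp only [map_zsmul, tupleToSingular_single, tupleFilling]
    change Finsupp.sum _ _ = 0
    refine Eq.trans (congrArg (fun z => Finsupp.sum z fun _ r => r) (Fin.sum_univ_two _)) ?_
    rw [Finsupp.sum_add_index' (fun _ => rfl) (fun _ _ _ => rfl)]
    simp [← Finsupp.single_neg, Finsupp.sum_single_index]
  | succ k =>
    change singularBoundary R X k _ = 0
    have h : singularBoundary R X k (tupleToSingular R (k + 1)
        (tupleBoundary R X (k + 1) (Finsupp.single x 1))) =
        tupleToSingular R k (tupleBoundary R X k (tupleBoundary R X (k + 1)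
          (Finsupp.single x 1))) := by
      rw [tupleBoundary_single]
      simp only [map_sum, map_zsmul, tupleToSingular_single]
      refine Finset.sum_congr rfl fun i _ => ?_
      rw [show singularBoundary R X k (tupleFilling R (k + 1) _) = _ from hx i]
    rw [h, tupleBoundary_tupleBoundary, map_zero]

theorem tupleToSingular_tupleBoundary_mem {k : ℕ} {x : Fin (k + 2) → X} {S : Set X}
    (hx : ∀ i : Fin (k + 2), tupleFilling R k (fun j => x (i.succAbove j)) ∈ singularIn R S k) :
    tupleToSingular R k (tupleBoundary R X k (Finsupp.single x 1)) ∈ singularIn R S k := by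
  rw [tupleBoundary_single, map_sum]
  refine Submodule.sum_mem _ fun i _ => ?_
  rw [map_zsmul, tupleToSingular_single]
  exact zsmul_mem (hx i) _

/-- The sole source of size bounds on fillings: any filling of the boundary within radius `ρ` bounds
the chosen one, with error at most the diameter. -/
theorem tupleFilling_succ_spec {k : ℕ} {x : Fin (k + 2) → X} {ρ : ℝ} (hρ : 0 ≤ ρ)
    (h : ∃ w ∈ singularIn R (Metric.closedBall (x 0) ρ) (k + 1), singularBoundary R X k w =
      tupleToSingular R k (tupleBoundary R X k (Finsupp.single x 1))) :
    IsFilled R (k + 1) x ∧ tupleFilling R (k + 1) x ∈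
      singularIn R (Metric.closedBall (x 0) (ρ + Metric.diam (Set.range x))) (k + 1) := by
  by_cases hx : ∃ i, x i ≠ x 0
  · obtain ⟨i, hi⟩ := hx
    have hpos : 0 < Metric.diam (Set.range x) :=
      (dist_pos.2 hi).trans_le
        (Metric.dist_le_diam_of_mem (Set.finite_range x).isBounded ⟨i, rfl⟩ ⟨0, rfl⟩)
    have hex := exists_isNearOptimalFilling hpos hρ h
    have heq : tupleFilling R (k + 1) x = hex.choose := by
      rw [tupleFilling]
      exact dif_pos ⟨⟨i, hi⟩, hex⟩
    rw [IsFilled, heq]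
    exact ⟨hex.choose_spec.1, hex.choose_spec.2 ρ hρ h⟩
  · push Not at hx
    rw [IsFilled, tupleFilling_of_forall_eq hx, map_zero,
      tupleToSingular_tupleBoundary_of_forall_eq hx]
    exact ⟨rfl, zero_mem _⟩

/-- Small tuples have small fillings. -/
theorem exists_nhds_tupleFilling_mem {b : X} {L : ℝ}
    (hL : ∀ x : X, L < dist x b → ∀ n, ∀ U ∈ 𝓝 x, ∃ V ∈ 𝓝 x, FillsIn R V U n) (k : ℕ) {y : X}
    (hy : L < dist y b) {U : Set X} (hU : U ∈ 𝓝 y) :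
    ∃ V ∈ 𝓝 y, ∀ x ∈ tuplesIn V k, IsFilled R k x ∧ tupleFilling R k x ∈ singularIn R U k := by
  induction k generalizing U with
  | zero =>
    exact ⟨U, hU, fun x hx => ⟨trivial, Finsupp.single_mem_supported R _ fun _ => hx 0⟩⟩
  | succ k ih =>
    obtain ⟨ε, hε, hεU⟩ := Metric.mem_nhds_iff.1 hU
    -- If the entries and a filling lie within `ε / 8` of `y`, the filling has radius `ε / 4` about
    -- `x 0`. The diameter adds at most `ε / 4` and recentring at `y` another `ε / 8`, which stays
    -- below `ε`.
    obtain ⟨V₁, hV₁, hfill⟩ := hL y hy k _ (Metric.ball_mem_nhds y (show 0 < ε / 8 by positivity))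
    obtain ⟨V₂, hV₂, hV⟩ := ih hV₁
    refine ⟨V₂ ∩ Metric.ball y (ε / 8),
      Filter.inter_mem hV₂ (Metric.ball_mem_nhds y (by positivity)), fun x hx => ?_⟩
    have hface := fun i : Fin (k + 2) => hV (fun j => x (i.succAbove j)) fun j => (hx _).1
    obtain ⟨w, hw, hwz⟩ := hfill _ (tupleToSingular_tupleBoundary_mem fun i => (hface i).2)
      (isReducedCycle_tupleToSingular fun i => (hface i).1)
    have hx0 : dist (x 0) y < ε / 8 := (hx 0).2
    have hspec := tupleFilling_succ_spec (show 0 ≤ ε / 4 by positivity)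
      ⟨w, singularIn_mono (fun p hp => ?_) _ hw, hwz⟩
    · refine ⟨hspec.1, singularIn_mono (fun p hp => hεU ?_) _ hspec.2⟩
      have hdiam : Metric.diam (Set.range x) ≤ ε / 4 := by
        refine Metric.diam_le_of_forall_dist_le (by positivity) ?_
        rintro _ ⟨i, rfl⟩ _ ⟨j, rfl⟩
        have hi : dist (x i) y < ε / 8 := (hx i).2
        have hj : dist (x j) y < ε / 8 := (hx j).2
        linarith [dist_triangle_right (x i) (x j) y]
      rw [Metric.mem_closedBall] at hp
      rw [Metric.mem_ball]
      linarith [dist_triangle p (x 0) y]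
    · rw [Metric.mem_ball] at hp
      rw [Metric.mem_closedBall]
      linarith [dist_triangle_right p (x 0) y]

/-- Far away, tuples have fillings whose distance to the tuple is controlled by its diameter. -/
theorem exists_tupleFilling_mem_closedBall {b : X}
    (hM : ∀ q : ℝ, 0 ≤ q → ∃ M P : ℝ, 0 ≤ P ∧ ∀ x : X, M ≤ dist x b → ∀ n,
      FillsIn R (Metric.closedBall x q) (Metric.closedBall x P) n) (k : ℕ) {r : ℝ} (hr : 0 ≤ r) :
    ∃ M P : ℝ, 0 ≤ P ∧ ∀ x : Fin (k + 1) → X, (∀ i j, dist (x i) (x j) ≤ r) → M ≤ dist (x 0) b →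
      IsFilled R k x ∧ tupleFilling R k x ∈ singularIn R (Metric.closedBall (x 0) P) k := by
  induction k with
  | zero =>
    exact ⟨0, 0, le_rfl, fun x _ _ => ⟨trivial, Finsupp.single_mem_supported R _ fun _ => by simp⟩⟩
  | succ k ih =>
    obtain ⟨M, P, hP, h⟩ := ih
    -- The fillings of the faces have radius `P` about their own first entries, which lie within `r`
    -- of `x 0`.
    obtain ⟨M', P', hP', h'⟩ := hM (r + P) (by positivity)
    refine ⟨max M' (M + r), P' + r, by positivity, fun x hx hfar => ?_⟩
    have hface := fun i : Fin (k + 2) => h (fun j => x (i.succAbove j)) (fun _ _ => hx _ _) (by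
      linarith [le_max_right M' (M + r), dist_triangle (x 0) (x (i.succAbove 0)) b,
        hx 0 (i.succAbove 0)])
    have hspec := tupleFilling_succ_spec hP' (h' (x 0) ((le_max_left _ _).trans hfar) k _
      (tupleToSingular_tupleBoundary_mem fun i => singularIn_mono (fun p hp => ?_) _ (hface i).2)
      (isReducedCycle_tupleToSingular fun i => (hface i).1))
    · refine ⟨hspec.1, singularIn_mono (Metric.closedBall_subset_closedBall ?_) _ hspec.2⟩
      refine add_le_add le_rfl (Metric.diam_le_of_forall_dist_le hr ?_)
      rintro _ ⟨i, rfl⟩ _ ⟨j, rfl⟩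
      exact hx i j
    · rw [Metric.mem_closedBall] at hp ⊢
      linarith [dist_triangle p (x (i.succAbove 0)) (x 0), hx (i.succAbove 0) 0]

end TupleToSingular

/-! ### The homotopy to small tuples, and making cochains coarse -/

section Homotopy

variable (R : Type v) [Ring R] {X : Type u} [MetricSpace X] (𝒰 : Set (Set X))

/-- Replaces tuples by chains of tuples that are small for the cover `𝒰`. -/
def smallReplacement (k : ℕ) : TupleChain R X k →ₗ[R] TupleChain R X k :=
  singularToTuple R 𝒰 k ∘ₗ tupleToSingular R k

/-- The homotopy between a tuple and its replacement by small tuples. -/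
def replacementHomotopyTuple : (k : ℕ) → (Fin (k + 1) → X) → TupleChain R X (k + 1)
  -- In degree zero the replacement is the identity, so no homotopy is needed.
  | 0, _ => 0
  | k + 1, x => tupleCone R (x 0) (k + 1) (Finsupp.single x 1 -
      smallReplacement R 𝒰 (k + 1) (Finsupp.single x 1) -
      Finsupp.linearCombination R (replacementHomotopyTuple k)
        (tupleBoundary R X k (Finsupp.single x 1)))

/-- The linear extension of `replacementHomotopyTuple`. -/
def replacementHomotopy (k : ℕ) : TupleChain R X k →ₗ[R] TupleChain R X (k + 1) :=
  Finsupp.linearCombination R (replacementHomotopyTuple R 𝒰 k)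

/-- The homotopy formula holds for the tuple `x`. -/
def HomotopyFormula : (k : ℕ) → (Fin (k + 1) → X) → Prop
  | 0, _ => True
  | k + 1, x => tupleBoundary R X (k + 1) (replacementHomotopyTuple R 𝒰 (k + 1) x) =
      Finsupp.single x 1 - smallReplacement R 𝒰 (k + 1) (Finsupp.single x 1) -
        replacementHomotopy R 𝒰 k (tupleBoundary R X k (Finsupp.single x 1))

variable {R 𝒰}

@[simp]
theorem replacementHomotopy_single {k : ℕ} (x : Fin (k + 1) → X) :
    replacementHomotopy R 𝒰 k (Finsupp.single x 1) = replacementHomotopyTuple R 𝒰 k x := by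
  simp [replacementHomotopy]

theorem replacementHomotopyTuple_succ {k : ℕ} (x : Fin (k + 2) → X) :
    replacementHomotopyTuple R 𝒰 (k + 1) x = tupleCone R (x 0) (k + 1) (Finsupp.single x 1 -
      smallReplacement R 𝒰 (k + 1) (Finsupp.single x 1) -
      replacementHomotopy R 𝒰 k (tupleBoundary R X k (Finsupp.single x 1))) := rfl

theorem smallReplacement_zero (z : TupleChain R X 0) : smallReplacement R 𝒰 0 z = z := by
  change smallReplacement R 𝒰 0 z = LinearMap.id (R := R) z
  congr 1
  refine linearMap_ext_single fun x => ?_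
  rw [smallReplacement, LinearMap.comp_apply, tupleToSingular_single, tupleFilling,
    singularToTuple_zero_single, LinearMap.id_apply]
  congr 1
  funext k
  exact congrArg x (Fin.ext (by omega))

/-- The chain `x - Tx - H∂x` is a cycle: `T` commutes with the boundary at a filled tuple, and the
formula on the faces computes `∂H∂x`. Coning a cycle from `x 0` fills it. -/
theorem homotopyFormula_succ (hopen : ∀ U ∈ 𝒰, IsOpen U) (hcover : ∀ x : X, ∃ U ∈ 𝒰, x ∈ U)
    {k : ℕ} {x : Fin (k + 2) → X} (hx : IsFilled R (k + 1) x)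
    (hface : ∀ i : Fin (k + 2), HomotopyFormula R 𝒰 k fun j => x (i.succAbove j)) :
    HomotopyFormula R 𝒰 (k + 1) x := by
  have hT : tupleBoundary R X k (smallReplacement R 𝒰 (k + 1) (Finsupp.single x 1)) =
      smallReplacement R 𝒰 k (tupleBoundary R X k (Finsupp.single x 1)) := by
    rw [smallReplacement, LinearMap.comp_apply, tupleBoundary_singularToTuple hopen hcover,
      tupleToSingular_single, show singularBoundary R X k (tupleFilling R (k + 1) x) = _ from hx]
    rfl
  have hH : tupleBoundary R X k (replacementHomotopy R 𝒰 k
      (tupleBoundary R X k (Finsupp.single x 1))) =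
      tupleBoundary R X k (Finsupp.single x 1) -
        smallReplacement R 𝒰 k (tupleBoundary R X k (Finsupp.single x 1)) := by
    cases k with
    | zero =>
      rw [smallReplacement_zero, sub_self, tupleBoundary_single, map_sum]
      simp [replacementHomotopyTuple]
    | succ k =>
      have h : tupleBoundary R X (k + 1) (replacementHomotopy R 𝒰 (k + 1)
          (tupleBoundary R X (k + 1) (Finsupp.single x 1))) =
          tupleBoundary R X (k + 1) (Finsupp.single x 1) -
          smallReplacement R 𝒰 (k + 1) (tupleBoundary R X (k + 1) (Finsupp.single x 1)) -
          replacementHomotopy R 𝒰 k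
            (tupleBoundary R X k (tupleBoundary R X (k + 1) (Finsupp.single x 1))) := by
        rw [tupleBoundary_single]
        simp only [map_sum, map_zsmul, replacementHomotopy_single,
          ← Finset.sum_sub_distrib]
        refine Finset.sum_congr rfl fun i _ => ?_
        rw [show tupleBoundary R X (k + 1) (replacementHomotopyTuple R 𝒰 (k + 1) _) = _ from
          hface i, smul_sub, smul_sub]
      rw [h, tupleBoundary_tupleBoundary, map_zero, sub_zero]
  have hw : tupleBoundary R X k (Finsupp.single x 1 -
      smallReplacement R 𝒰 (k + 1) (Finsupp.single x 1) -
      replacementHomotopy R 𝒰 k (tupleBoundary R X k (Finsupp.single x 1))) = 0 := by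
    rw [map_sub, map_sub, hT, hH, sub_self]
  rw [HomotopyFormula, replacementHomotopyTuple_succ, tupleBoundary_tupleCone, hw, map_zero,
    sub_zero]

theorem replacementHomotopyTuple_succ_mem (hopen : ∀ U ∈ 𝒰, IsOpen U)
    (hcover : ∀ x : X, ∃ U ∈ 𝒰, x ∈ U) {k : ℕ} {x : Fin (k + 2) → X} {S : Set X}
    (hxS : x ∈ tuplesIn S (k + 1)) (hx : tupleFilling R (k + 1) x ∈ singularIn R S (k + 1))
    (hface : ∀ i : Fin (k + 2), replacementHomotopyTuple R 𝒰 k (fun j => x (i.succAbove j)) ∈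
      Finsupp.supported R R (tuplesIn S (k + 1))) :
    replacementHomotopyTuple R 𝒰 (k + 1) x ∈ Finsupp.supported R R (tuplesIn S (k + 2)) := by
  rw [replacementHomotopyTuple_succ]
  refine tupleCone_mem_supported (fun t ht => cons_mem_tuplesIn (hxS 0) ht)
    (sub_mem (sub_mem (Finsupp.single_mem_supported R _ hxS) ?_) ?_)
  · rw [smallReplacement, LinearMap.comp_apply, tupleToSingular_single]
    exact Finsupp.supported_mono Set.inter_subset_left (singularToTuple_mem hopen hcover hx)
  · rw [tupleBoundary_single, map_sum]
    refine Submodule.sum_mem _ fun i _ => ?_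
    rw [map_zsmul, replacementHomotopy_single]
    exact zsmul_mem (hface i) _

theorem exists_nhds_replacementHomotopyTuple_mem (hopen : ∀ U ∈ 𝒰, IsOpen U)
    (hcover : ∀ x : X, ∃ U ∈ 𝒰, x ∈ U) {b : X} {L : ℝ}
    (hL : ∀ x : X, L < dist x b → ∀ n, ∀ U ∈ 𝓝 x, ∃ V ∈ 𝓝 x, FillsIn R V U n) (k : ℕ) {y : X}
    (hy : L < dist y b) {U : Set X} (hU : U ∈ 𝓝 y) :
    ∃ V ∈ 𝓝 y, ∀ x ∈ tuplesIn V k,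
      replacementHomotopyTuple R 𝒰 k x ∈ Finsupp.supported R R (tuplesIn U (k + 1)) := by
  induction k with
  | zero => exact ⟨U, hU, fun _ _ => zero_mem _⟩
  | succ k ih =>
    obtain ⟨V₁, hV₁, h₁⟩ := exists_nhds_tupleFilling_mem hL (k + 1) hy hU
    obtain ⟨V₂, hV₂, h₂⟩ := ih
    refine ⟨V₁ ∩ V₂ ∩ U, Filter.inter_mem (Filter.inter_mem hV₁ hV₂) hU, fun x hx => ?_⟩
    exact replacementHomotopyTuple_succ_mem hopen hcover (fun i => (hx i).2)
      (h₁ x fun i => (hx i).1.1).2 fun i => h₂ _ fun j => (hx _).1.2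

theorem exists_replacementHomotopyTuple_mem_closedBall (hopen : ∀ U ∈ 𝒰, IsOpen U)
    (hcover : ∀ x : X, ∃ U ∈ 𝒰, x ∈ U) {b : X}
    (hM : ∀ q : ℝ, 0 ≤ q → ∃ M P : ℝ, 0 ≤ P ∧ ∀ x : X, M ≤ dist x b → ∀ n,
      FillsIn R (Metric.closedBall x q) (Metric.closedBall x P) n) (k : ℕ) {r : ℝ} (hr : 0 ≤ r) :
    ∃ M P : ℝ, 0 ≤ P ∧ ∀ x : Fin (k + 1) → X, (∀ i j, dist (x i) (x j) ≤ r) → M ≤ dist (x 0) b →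
      HomotopyFormula R 𝒰 k x ∧ replacementHomotopyTuple R 𝒰 k x ∈
        Finsupp.supported R R (tuplesIn (Metric.closedBall (x 0) P) (k + 1)) := by
  induction k with
  | zero => exact ⟨0, 0, le_rfl, fun _ _ _ => ⟨trivial, zero_mem _⟩⟩
  | succ k ih =>
    obtain ⟨M, P, hP, h⟩ := ih
    obtain ⟨M', P', hP', h'⟩ := exists_tupleFilling_mem_closedBall hM (k + 1) hr
    refine ⟨max M' (M + r), P + r + P', by positivity, fun x hx hfar => ?_⟩
    have hface := fun i : Fin (k + 2) => h (fun j => x (i.succAbove j)) (fun _ _ => hx _ _) (by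
      linarith [le_max_right M' (M + r), dist_triangle (x 0) (x (i.succAbove 0)) b,
        hx 0 (i.succAbove 0)])
    have hfill := h' x hx ((le_max_left _ _).trans hfar)
    refine ⟨homotopyFormula_succ hopen hcover hfill.1 fun i => (hface i).1,
      replacementHomotopyTuple_succ_mem hopen hcover (fun i => ?_)
        (singularIn_mono (Metric.closedBall_subset_closedBall (by linarith)) _ hfill.2)
        fun i => Finsupp.supported_mono (fun t ht j => ?_) (hface i).2⟩
    · rw [Metric.mem_closedBall]
      linarith [hx i 0]
    · have := Metric.mem_closedBall.1 (ht j)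
      rw [Metric.mem_closedBall]
      linarith [dist_triangle (t j) (x (i.succAbove 0)) (x 0), hx (i.succAbove 0) 0]

theorem linearCombination_eq_zero {α : Type*} {φ : α → R} {s : Set α} (h : ∀ a ∈ s, φ a = 0)
    {z : α →₀ R} (hz : z ∈ Finsupp.supported R R s) : Finsupp.linearCombination R φ z = 0 := by
  have := map_mem_of_mem_supported R (Finsupp.linearCombination R φ) (Q := ⊥)
    (fun a ha => by simp [h a ha]) hz
  simpa using this

/-- Being near the diagonal amounts, up to a change of constant, to having bounded diameter, and
among such tuples boundedness is detected by the first entry. -/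
theorem mem_coarseCochain_iff (b : X) {n : ℕ} {φ : Cochain X R n} :
    φ ∈ coarseCochain X R n ↔ ∀ r : ℝ, 0 ≤ r → ∃ M : ℝ, ∀ x : Fin (n + 1) → X,
      (∀ i j, dist (x i) (x j) ≤ r) → M ≤ dist (x 0) b → φ x = 0 := by
  constructor
  · intro h r hr
    obtain ⟨M, hM⟩ := (Metric.isBounded_iff_subset_closedBall fun _ => b).1 (h ⟨r, hr⟩)
    refine ⟨M + 1, fun x hx hfar => ?_⟩
    by_contra hφ
    have hmem : x ∈ Metric.cthickening r (diagonal X n) :=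
      Metric.mem_cthickening_of_dist_le _ (fun _ => x 0) _ _ ⟨x 0, rfl⟩
        ((dist_pi_le_iff hr).2 fun i => hx i 0)
    have := (dist_le_pi_dist x (fun _ => b) 0).trans (Metric.mem_closedBall.1 (hM ⟨hφ, hmem⟩))
    linarith
  · intro h r
    have hr1 : (0 : ℝ) < (r : ℝ) + 1 := by positivity
    obtain ⟨M, hM⟩ := h (2 * (r + 1)) (by positivity)
    refine (Metric.isBounded_iff_subset_closedBall fun _ => b).2 ⟨max M 0 + 2 * (r + 1), ?_⟩
    rintro x ⟨hφ, hx⟩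
    obtain ⟨_, ⟨y, rfl⟩, hy⟩ := Metric.mem_thickening_iff.1
      (Metric.cthickening_subset_thickening' hr1 (lt_add_one (r : ℝ)) _ hx)
    have hy' := (dist_pi_lt_iff hr1).1 hy
    have hd (i j) : dist (x i) (x j) ≤ 2 * (r + 1) := by
      linarith [dist_triangle_right (x i) (x j) y, hy' i, hy' j]
    have h0 : dist (x 0) b < M := by
      by_contra! hfar
      exact hφ (hM x hd hfar)
    refine Metric.mem_closedBall.2 ((dist_pi_le_iff (by positivity)).2 fun k => ?_)
    linarith [dist_triangle (x k) (x 0) b, hd k 0, le_max_left M 0]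

/-- Far away from `b`, the cochain `φ` vanishes near the diagonal. -/
def FarLocallyZero (b : X) {n : ℕ} (φ : Cochain X R n) : Prop :=
  ∃ L : ℝ, ∀ y : X, L < dist y b → ∃ U ∈ 𝓝 y, ∀ x ∈ tuplesIn U n, φ x = 0

/-- A cochain that is locally zero at infinity and whose coboundary is coarse is cohomologous to a
coarse cochain. -/
theorem exists_sub_coboundary_mem_coarseCochain (hunif : UniformlyAcyclicAtInfinity.{u, v} R X)
    (hloc : LocallyAcyclicAtInfinity.{u, v} R X) (b : X) {n : ℕ} {φ : Cochain X R (n + 1)}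
    (hφ : FarLocallyZero b φ) (hdφ : coboundary X R (n + 1) φ ∈ coarseCochain X R (n + 2)) :
    ∃ ψ : Cochain X R n, FarLocallyZero b ψ ∧
      φ - coboundary X R n ψ ∈ coarseCochain X R (n + 1) := by
  obtain ⟨L, hL⟩ := hφ
  obtain ⟨L', hL'⟩ := hloc.exists_fillsIn_nhds b
  have hM := fun q (hq : 0 ≤ q) => hunif.exists_fillsIn_closedBall b hq
  -- Near the ball of radius `L` nothing is known about `φ`, so one larger ball completes the cover.
  -- Sufficiently far tuples have fillings that miss it.
  let 𝒰 : Set (Set X) :=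
    {U | IsOpen U ∧ ((∀ x ∈ tuplesIn U (n + 1), φ x = 0) ∨ U ⊆ Metric.ball b (L + 1))}
  have hopen : ∀ U ∈ 𝒰, IsOpen U := fun U hU => hU.1
  have hcover : ∀ y : X, ∃ U ∈ 𝒰, y ∈ U := by
    intro y
    rcases lt_or_ge L (dist y b) with h | h
    · obtain ⟨U, hU, hUφ⟩ := hL y h
      exact ⟨interior U, ⟨isOpen_interior, Or.inl fun x hx => hUφ x fun i =>
        interior_subset (hx i)⟩, mem_interior_iff_mem_nhds.2 hU⟩
    · exact ⟨Metric.ball b (L + 1), ⟨Metric.isOpen_ball, Or.inr subset_rfl⟩,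
        Metric.mem_ball.2 (by linarith)⟩
  -- The cochain `φ ∘ H`.
  refine ⟨fun x => Finsupp.linearCombination R φ (replacementHomotopyTuple R 𝒰 n x),
    ⟨max L L', fun y hy => ?_⟩, (mem_coarseCochain_iff b).2 fun r hr => ?_⟩
  · obtain ⟨U, hU, hUφ⟩ := hL y ((le_max_left _ _).trans_lt hy)
    obtain ⟨V, hV, hVU⟩ := exists_nhds_replacementHomotopyTuple_mem hopen hcover hL' n
      ((le_max_right _ _).trans_lt hy) hU
    exact ⟨V, hV, fun x hx => linearCombination_eq_zero hUφ (hVU x hx)⟩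
  · obtain ⟨M₁, P₁, hP₁, h₁⟩ := exists_tupleFilling_mem_closedBall hM (n + 1) hr
    obtain ⟨M₂, P₂, hP₂, h₂⟩ := exists_replacementHomotopyTuple_mem_closedBall hopen hcover hM
      (n + 1) hr
    -- Tuples occurring in `Hx` lie in a ball of radius `P₂` about `x 0`, hence have diameter at
    -- most `2 * P₂`.
    obtain ⟨M₃, h₃⟩ := (mem_coarseCochain_iff b).1 hdφ (2 * P₂) (by positivity)
    refine ⟨max (max M₁ M₂) (max (M₃ + P₂) (L + 1 + P₁)), fun x hx hfar => ?_⟩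
    simp only [max_le_iff] at hfar
    have hfill := h₁ x hx hfar.1.1
    obtain ⟨hformula, hmem⟩ := h₂ x hx hfar.1.2
    have hψ : coboundary X R n
        (fun x => Finsupp.linearCombination R φ (replacementHomotopyTuple R 𝒰 n x)) x =
        Finsupp.linearCombination R φ (replacementHomotopy R 𝒰 n
          (tupleBoundary R X n (Finsupp.single x 1))) := by
      rw [tupleBoundary_single, coboundary_apply]
      simp only [map_sum, map_zsmul, replacementHomotopy_single]
    have hsmall : Finsupp.linearCombination R φ
        (smallReplacement R 𝒰 (n + 1) (Finsupp.single x 1)) = 0 := by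
      rw [smallReplacement, LinearMap.comp_apply, tupleToSingular_single]
      refine linearCombination_eq_zero ?_ (singularToTuple_mem hopen hcover hfill.2)
      rintro t ⟨ht, U, ⟨-, hU | hU⟩, htU⟩
      · exact hU t htU
      · have h0 := Metric.mem_ball.1 (hU (htU 0))
        have h1 := Metric.mem_closedBall'.1 (ht 0)
        linarith [dist_triangle (x 0) (t 0) b]
    have hcob : Finsupp.linearCombination R φ
        (tupleBoundary R X (n + 1) (replacementHomotopyTuple R 𝒰 (n + 1) x)) = 0 := by
      rw [linearCombination_tupleBoundary]
      refine linearCombination_eq_zero (fun t ht => h₃ t (fun i j => ?_) ?_) hmem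
      · have hi := Metric.mem_closedBall.1 (ht i)
        have hj := Metric.mem_closedBall.1 (ht j)
        linarith [dist_triangle_right (t i) (t j) (x 0)]
      · have h0 := Metric.mem_closedBall'.1 (ht 0)
        linarith [dist_triangle (x 0) (t 0) b]
    rw [show tupleBoundary R X (n + 1) (replacementHomotopyTuple R 𝒰 (n + 1) x) = _ from hformula,
      map_sub, map_sub, hsmall, sub_zero, Finsupp.linearCombination_single, one_smul] at hcob
    rw [Pi.sub_apply, hψ]
    exact hcob

end Homotopy

/-! ### Exactness of the full cochain complex -/

section Comparison

variable {R : Type v} [Ring R]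

theorem mem_locallyZero_iff {Y : Type u} [TopologicalSpace Y] {n : ℕ} {φ : Cochain Y R n} :
    φ ∈ locallyZero Y R n ↔ ∀ y : Y, ∃ U ∈ 𝓝 y, ∀ x ∈ tuplesIn U n, φ x = 0 := by
  constructor
  · intro h y
    have hy : (fun _ => y) ∉ closure (Function.support φ) := fun hc =>
      Set.eq_empty_iff_forall_notMem.1 h _ ⟨⟨y, rfl⟩, hc⟩
    have hmem : (closure (Function.support φ))ᶜ ∈ 𝓝 (fun _ : Fin (n + 1) => y) :=
      isClosed_closure.isOpen_compl.mem_nhds hy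
    rw [nhds_pi, Filter.mem_pi'] at hmem
    obtain ⟨I, t, ht, hI⟩ := hmem
    refine ⟨⋂ i, t i, Filter.iInter_mem.2 ht, fun x hx => ?_⟩
    by_contra hφ
    exact hI (fun i _ => Set.mem_iInter.1 (hx i) i) (subset_closure hφ)
  · intro h
    refine Set.eq_empty_iff_forall_notMem.2 ?_
    rintro _ ⟨⟨y, rfl⟩, hc⟩
    obtain ⟨U, hU, hφ⟩ := h y
    obtain ⟨x, hxU, hx⟩ := mem_closure_iff_nhds.1 hc _
      (set_pi_mem_nhds (Set.toFinite Set.univ) fun _ _ => hU)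
    exact hx (hφ x fun i => hxU i trivial)

variable (R) in
/-- The cone operator on cochains, with apex `b`. -/
def coneCochain {X : Type u} (b : X) (n : ℕ) : Cochain X R (n + 1) →ₗ[R] Cochain X R n where
  toFun φ := fun x => φ (Fin.cons b x)
  map_add' _ _ := rfl
  map_smul' _ _ := rfl

theorem coboundary_coneCochain {X : Type u} (b : X) {n : ℕ} {φ : Cochain X R (n + 1)}
    (hφ : coboundary X R (n + 1) φ = 0) : coboundary X R n (coneCochain R b n φ) = φ := by
  funext x
  have h : coboundary X R (n + 1) φ (Fin.cons b x) = 0 := congrFun hφ _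
  rw [coboundary_apply, Fin.sum_univ_succ] at h
  simp only [Fin.val_zero, pow_zero, one_smul, Fin.zero_succAbove, Fin.cons_succ, Fin.val_succ,
    pow_succ, mul_neg_one, neg_smul, Finset.sum_neg_distrib] at h
  rw [← sub_eq_add_neg, sub_eq_zero] at h
  rw [coboundary_apply]
  refine Eq.trans (Finset.sum_congr rfl fun i _ => ?_) h.symm
  congr 1
  change φ _ = φ _
  congr 1
  funext k
  refine Fin.cases ?_ (fun k => ?_) k <;> simp

theorem eq_constCochain_of_coboundary_eq_zero {X : Type u} (b : X) {φ : Cochain X R 0}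
    (hφ : coboundary X R 0 φ = 0) : φ = constCochain X R (φ fun _ => b) := by
  funext x
  have h : coboundary X R 0 φ (Fin.cons b x) = 0 := congrFun hφ _
  rw [coboundary_apply] at h
  refine (sub_eq_zero.1 (Eq.trans ?_ h))
  refine Eq.trans ?_ (Fin.sum_univ_two _).symm
  simp only [Fin.val_zero, pow_zero, one_smul, Fin.val_one, pow_one, neg_smul, ← sub_eq_add_neg]
  change φ x - φ (fun _ => b) = _
  congr 2
  funext k
  obtain rfl : k = 0 := Fin.ext (by omega)
  rfl

/-! ### Cochains locally zero at infinity and Alexander–Spanier classes outside balls -/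

variable {X : Type u} [MetricSpace X]

/-- Restriction of cochains to the complement of a ball. -/
def restrictOutside (R : Type v) [Ring R] (b : X) (r : ℝ≥0) (n : ℕ) :
    Cochain X R n →ₗ[R] Cochain (outside b r) R n :=
  pullback R Subtype.val n

theorem restrictOutside_mem_locallyZero_iff {b : X} {r : ℝ≥0} {n : ℕ} {φ : Cochain X R n} :
    restrictOutside R b r n φ ∈ locallyZero (outside b r) R n ↔
      ∀ y : X, r < dist y b → ∃ U ∈ 𝓝 y, ∀ x ∈ tuplesIn U n, φ x = 0 := by
  rw [mem_locallyZero_iff]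
  have hopen : IsOpen (outside b r) := Metric.isClosed_closedBall.isOpen_compl
  constructor
  · intro h y hy
    have hyo : y ∈ outside b r := fun hc => not_le.2 hy (Metric.mem_closedBall.1 hc)
    obtain ⟨U, hU, hφ⟩ := h ⟨y, hyo⟩
    refine ⟨Subtype.val '' U, ?_, fun x hx => ?_⟩
    · rw [← map_nhds_subtype_coe_eq_nhds hyo (hopen.mem_nhds hyo)]
      exact Filter.image_mem_map hU
    · choose x' hx' hxx' using hx
      rw [← funext hxx']
      exact hφ x' hx'
  · rintro h ⟨y, hy⟩
    obtain ⟨U, hU, hφ⟩ := h y (not_le.1 fun hc => hy (Metric.mem_closedBall.2 hc))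
    exact ⟨Subtype.val ⁻¹' U, continuous_subtype_val.continuousAt.preimage_mem_nhds hU,
      fun x hx => hφ _ hx⟩

theorem farLocallyZero_iff {b : X} {n : ℕ} {φ : Cochain X R n} :
    FarLocallyZero b φ ↔
      ∃ r : ℝ≥0, restrictOutside R b r n φ ∈ locallyZero (outside b r) R n := by
  simp only [restrictOutside_mem_locallyZero_iff]
  constructor
  · rintro ⟨L, hL⟩
    exact ⟨L.toNNReal, fun y hy => hL y ((Real.le_coe_toNNReal L).trans_lt hy)⟩
  · rintro ⟨r, hr⟩
    exact ⟨r, hr⟩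

theorem farLocallyZero_of_mem_coarseCochain (b : X) {n : ℕ} {φ : Cochain X R n}
    (hφ : φ ∈ coarseCochain X R n) : FarLocallyZero b φ := by
  obtain ⟨M, hM⟩ := (mem_coarseCochain_iff b).1 hφ 2 (by norm_num)
  refine ⟨M + 1, fun y hy => ⟨Metric.ball y 1, Metric.ball_mem_nhds y one_pos,
    fun x hx => hM x (fun i j => ?_) ?_⟩⟩
  · linarith [dist_triangle_right (x i) (x j) y, Metric.mem_ball.1 (hx i), Metric.mem_ball.1 (hx j)]
  · linarith [dist_triangle y (x 0) b, Metric.mem_ball'.1 (hx 0)]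

/-- A single point always lies on the diagonal, so in degree zero being locally zero at infinity
already means bounded support. -/
theorem mem_coarseCochain_zero {b : X} {φ : Cochain X R 0} (hφ : FarLocallyZero b φ) :
    φ ∈ coarseCochain X R 0 := by
  obtain ⟨L, hL⟩ := hφ
  refine (mem_coarseCochain_iff b).2 fun r _ => ⟨L + 1, fun x _ hx => ?_⟩
  obtain ⟨U, hU, h⟩ := hL (x 0) (by linarith)
  refine h x fun i => ?_
  obtain rfl : i = 0 := Fin.ext (by omega)
  exact mem_of_mem_nhds hU

theorem restrictOutside_surjective (b : X) (r : ℝ≥0) (n : ℕ) :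
    Function.Surjective (restrictOutside R b r n) := by
  classical
  intro φ
  refine ⟨fun x => if h : ∀ i, x i ∈ outside b r then φ fun i => ⟨x i, h i⟩ else 0, ?_⟩
  funext x
  exact dif_pos fun i => (x i).2

/-- Cochains whose coboundary is locally zero outside a ball. -/
def outsideCocycles (R : Type v) [Ring R] (b : X) (n : ℕ) (r : ℝ≥0) :
    Submodule R (Cochain X R n) :=
  (locallyZero (outside b r) R (n + 1)).comap
    (restrictOutside R b r (n + 1) ∘ₗ coboundary X R n)

theorem mem_outsideCocycles {b : X} {n : ℕ} {r : ℝ≥0} {φ : Cochain X R n} :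
    φ ∈ outsideCocycles R b n r ↔
      restrictOutside R b r (n + 1) (coboundary X R n φ) ∈ locallyZero (outside b r) R (n + 1) :=
  Iff.rfl

theorem restrictOutside_mem_locallyZero_of_le {b : X} {r s : ℝ≥0} (h : r ≤ s) {n : ℕ}
    {φ : Cochain X R n} (hφ : restrictOutside R b r n φ ∈ locallyZero (outside b r) R n) :
    restrictOutside R b s n φ ∈ locallyZero (outside b s) R n :=
  restrictOutside_mem_locallyZero_iff.2 fun y hy =>
    restrictOutside_mem_locallyZero_iff.1 hφ y ((NNReal.coe_le_coe.2 h).trans_lt hy)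

theorem outsideCocycles_mono (b : X) (n : ℕ) : Monotone (outsideCocycles R b n) :=
  fun _ _ h _ hφ => mem_outsideCocycles.2
    (restrictOutside_mem_locallyZero_of_le h (mem_outsideCocycles.1 hφ))

/-- The Alexander–Spanier cocycle of a cochain whose coboundary is locally zero outside a ball. -/
def outsideASCocycle (R : Type v) [Ring R] (b : X) (n : ℕ) (r : ℝ≥0) :
    outsideCocycles R b n r →ₗ[R] LinearMap.ker (asD (outside b r) R n) :=
  LinearMap.codRestrict _
    (((locallyZero (outside b r) R n).mkQ ∘ₗ restrictOutside R b r n).domRestrict _) fun φ => by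
      have h : asD (outside b r) R n ((locallyZero (outside b r) R n).mkQ
          (restrictOutside R b r n φ)) = (locallyZero (outside b r) R (n + 1)).mkQ
            (restrictOutside R b r (n + 1) (coboundary X R n φ)) := rfl
      rw [LinearMap.mem_ker]
      exact h.trans ((Submodule.Quotient.mk_eq_zero _).2 φ.2)

/-- The Alexander–Spanier class of a cochain whose coboundary is locally zero outside a ball. -/
def outsideClass (R : Type v) [Ring R] (b : X) (n : ℕ) (r : ℝ≥0) :
    outsideCocycles R b n r →ₗ[R] ReducedAS (outside b r) R n :=
  Submodule.mkQ _ ∘ₗ outsideASCocycle R b n r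

theorem outsideClass_surjective (b : X) (n : ℕ) (r : ℝ≥0) :
    Function.Surjective (outsideClass R b n r) := by
  intro z
  obtain ⟨⟨z, hz⟩, rfl⟩ := Submodule.mkQ_surjective _ z
  obtain ⟨φ, rfl⟩ := Submodule.mkQ_surjective _ z
  obtain ⟨φ, rfl⟩ := restrictOutside_surjective b r n φ
  have h : (locallyZero (outside b r) R (n + 1)).mkQ
      (restrictOutside R b r (n + 1) (coboundary X R n φ)) = 0 := hz
  exact ⟨⟨φ, mem_outsideCocycles.2 ((Submodule.Quotient.mk_eq_zero _).1 h)⟩, rfl⟩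

/-- Cocycles on all of `X` are constants in degree zero and coboundaries otherwise, so "differs from
a global cocycle" treats the augmentation and the higher degrees alike. -/
theorem outsideClass_eq_zero_iff (b : X) (n : ℕ) (r : ℝ≥0) (φ : outsideCocycles R b n r) :
    outsideClass R b n r φ = 0 ↔ ∃ χ : Cochain X R n, coboundary X R n χ = 0 ∧
      restrictOutside R b r n (φ - χ) ∈ locallyZero (outside b r) R n := by
  have hmem : outsideClass R b n r φ = 0 ↔
      (locallyZero (outside b r) R n).mkQ (restrictOutside R b r n φ) ∈
        reducedASCoboundaries (outside b r) R n :=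
    Submodule.Quotient.mk_eq_zero _
  have hmk (χ : Cochain X R n) : (locallyZero (outside b r) R n).mkQ (restrictOutside R b r n χ) =
      (locallyZero (outside b r) R n).mkQ (restrictOutside R b r n φ) ↔
      restrictOutside R b r n (φ - χ) ∈ locallyZero (outside b r) R n := by
    rw [eq_comm, map_sub]
    exact Submodule.Quotient.eq _
  rw [hmem]
  cases n with
  | zero =>
    constructor
    · rintro ⟨c, hc⟩
      refine ⟨constCochain X R c, ?_, (hmk _).1 hc⟩
      funext x
      simp [coboundary_apply, constCochain, Fin.sum_univ_two]
    · rintro ⟨χ, hχ, h⟩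
      rw [eq_constCochain_of_coboundary_eq_zero b hχ] at h
      exact ⟨χ fun _ => b, (hmk _).2 h⟩
  | succ n =>
    constructor
    · rintro ⟨ψ, hψ⟩
      obtain ⟨ψ, rfl⟩ := Submodule.mkQ_surjective _ ψ
      obtain ⟨ψ, rfl⟩ := restrictOutside_surjective b r n ψ
      exact ⟨coboundary X R n ψ, coboundary_coboundary X R n ψ, (hmk _).1 hψ⟩
    · rintro ⟨χ, hχ, h⟩
      refine ⟨(locallyZero (outside b r) R n).mkQ (restrictOutside R b r n (coneCochain R b n χ)),
        Eq.trans ?_ ((hmk _).2 h)⟩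
      conv_rhs => rw [← coboundary_coneCochain b hχ]
      rfl

/-! ### The direct limit and the comparison map -/

instance directedSystem_reducedAS (b : X) (n : ℕ) :
    DirectedSystem (fun r : ℝ≥0 => ReducedAS (outside b r) R n)
      fun _ _ h => ReducedAS.map R (outsideIncl b h) n where
  map_self r z := by
    obtain ⟨φ, rfl⟩ := outsideClass_surjective b n r z
    rfl
  map_map {r s t} hrs hst z := by
    obtain ⟨φ, rfl⟩ := outsideClass_surjective b n t z
    rfl

open Classical in
/-- The canonical map to the direct limit. -/
def toLimit (R : Type v) [Ring R] (b : X) (n : ℕ) (r : ℝ≥0) :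
    ReducedAS (outside b r) R n →ₗ[R] ReducedASAtInfinity R b n :=
  Module.DirectLimit.of R ℝ≥0 (fun r : ℝ≥0 => ReducedAS (outside b r) R n)
    (fun _ _ h => ReducedAS.map R (outsideIncl b h) n) r

theorem toLimit_map (b : X) (n : ℕ) {r s : ℝ≥0} (h : r ≤ s) (z : ReducedAS (outside b r) R n) :
    toLimit R b n s (ReducedAS.map R (outsideIncl b h) n z) = toLimit R b n r z :=
  Module.DirectLimit.of_f (hij := h)

theorem exists_toLimit (b : X) (n : ℕ) (z : ReducedASAtInfinity R b n) :
    ∃ r, ∃ w, toLimit R b n r w = z :=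
  Module.DirectLimit.exists_of z

theorem exists_map_eq_zero_of_toLimit_eq_zero (b : X) (n : ℕ) {r : ℝ≥0}
    {z : ReducedAS (outside b r) R n} (hz : toLimit R b n r z = 0) :
    ∃ s, ∃ h : r ≤ s, ReducedAS.map R (outsideIncl b h) n z = 0 :=
  Module.DirectLimit.of.zero_exact hz

theorem toLimit_outsideClass (b : X) (n : ℕ) {r s : ℝ≥0} {φ : Cochain X R n}
    (hr : φ ∈ outsideCocycles R b n r) (hs : φ ∈ outsideCocycles R b n s) :
    toLimit R b n r (outsideClass R b n r ⟨φ, hr⟩) =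
      toLimit R b n s (outsideClass R b n s ⟨φ, hs⟩) := by
  rw [← toLimit_map b n (le_max_left r s), ← toLimit_map b n (le_max_right r s)]
  rfl

theorem exists_mem_outsideCocycles (b : X) {n : ℕ} (ω : coarseCocycles X R (n + 1)) :
    ∃ r, coneCochain R b n ω ∈ outsideCocycles R b n r := by
  obtain ⟨r, hr⟩ := farLocallyZero_iff.1 (farLocallyZero_of_mem_coarseCochain b ω.2.1)
  refine ⟨r, mem_outsideCocycles.2 ?_⟩
  rwa [coboundary_coneCochain b ω.2.2]

/-- The class at infinity of a cochain whose coboundary is locally zero at infinity. -/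
def limitClass (b : X) (n : ℕ) (φ : Cochain X R n) (h : ∃ r, φ ∈ outsideCocycles R b n r) :
    ReducedASAtInfinity R b n :=
  toLimit R b n _ (outsideClass R b n _ ⟨φ, h.choose_spec⟩)

theorem limitClass_eq (b : X) {n : ℕ} {φ : Cochain X R n} {r : ℝ≥0}
    (hr : φ ∈ outsideCocycles R b n r) :
    limitClass b n φ ⟨r, hr⟩ = toLimit R b n r (outsideClass R b n r ⟨φ, hr⟩) :=
  toLimit_outsideClass b n _ hr

theorem limitClass_add (b : X) {n : ℕ} {φ ψ χ : Cochain X R n}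
    (hφ : ∃ r, φ ∈ outsideCocycles R b n r) (hψ : ∃ r, ψ ∈ outsideCocycles R b n r)
    (hχ : ∃ r, χ ∈ outsideCocycles R b n r) (h : χ = φ + ψ) :
    limitClass b n χ hχ = limitClass b n φ hφ + limitClass b n ψ hψ := by
  subst h
  obtain ⟨r, hr⟩ := hφ
  obtain ⟨s, hs⟩ := hψ
  have hr' := outsideCocycles_mono b n (le_max_left r s) hr
  have hs' := outsideCocycles_mono b n (le_max_right r s) hs
  rw [limitClass_eq b hr', limitClass_eq b hs', limitClass_eq b (add_mem hr' hs'), ← map_add,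
    ← map_add, AddMemClass.mk_add_mk]

theorem limitClass_smul (b : X) {n : ℕ} (c : R) {φ χ : Cochain X R n}
    (hφ : ∃ r, φ ∈ outsideCocycles R b n r) (hχ : ∃ r, χ ∈ outsideCocycles R b n r)
    (h : χ = c • φ) : limitClass b n χ hχ = c • limitClass b n φ hφ := by
  subst h
  obtain ⟨r, hr⟩ := hφ
  rw [limitClass_eq b hr, limitClass_eq b (Submodule.smul_mem _ c hr), ← map_smul, ← map_smul,
    SetLike.mk_smul_mk]

/-- Subtracting from `φ` a global cocycle `χ`, or a cochain `η` with the same coboundary, are the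
same operation: `η = φ - χ`. -/
theorem limitClass_eq_zero_iff (b : X) {n : ℕ} {φ : Cochain X R n}
    (hφ : ∃ r, φ ∈ outsideCocycles R b n r) :
    limitClass b n φ hφ = 0 ↔
      ∃ η : Cochain X R n, FarLocallyZero b η ∧ coboundary X R n η = coboundary X R n φ := by
  obtain ⟨r, hr⟩ := hφ
  constructor
  · intro h
    rw [limitClass_eq b hr] at h
    obtain ⟨s, hs, h⟩ := exists_map_eq_zero_of_toLimit_eq_zero b n h
    obtain ⟨χ, hχ, hχ'⟩ := (outsideClass_eq_zero_iff b n s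
      ⟨φ, outsideCocycles_mono b n hs hr⟩).1 h
    refine ⟨φ - χ, farLocallyZero_iff.2 ⟨s, hχ'⟩, ?_⟩
    rw [map_sub, hχ, sub_zero]
  · rintro ⟨η, hη, hηφ⟩
    obtain ⟨s, hs⟩ := farLocallyZero_iff.1 hη
    have hrs := outsideCocycles_mono b n (le_max_left r s) hr
    have h0 : outsideClass R b n (max r s) ⟨φ, hrs⟩ = 0 := by
      refine (outsideClass_eq_zero_iff b n (max r s) ⟨φ, hrs⟩).2 ⟨φ - η, ?_, ?_⟩
      · rw [map_sub, hηφ, sub_self]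
      · rw [sub_sub_cancel]
        exact restrictOutside_mem_locallyZero_of_le (le_max_right r s) hs
    rw [limitClass_eq b hrs, h0, map_zero]

theorem exists_limitClass_eq (b : X) (n : ℕ) (z : ReducedASAtInfinity R b n) :
    ∃ φ, ∃ h : ∃ r, φ ∈ outsideCocycles R b n r, limitClass b n φ h = z := by
  obtain ⟨r, z, rfl⟩ := exists_toLimit b n z
  obtain ⟨⟨φ, hφ⟩, rfl⟩ := outsideClass_surjective b n r z
  exact ⟨φ, ⟨r, hφ⟩, limitClass_eq b hφ⟩

/-- The comparison of coarse cocycles with the Alexander–Spanier cohomology at infinity. -/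
def cocycleComparison (R : Type v) [Ring R] (b : X) (n : ℕ) :
    coarseCocycles X R (n + 1) →ₗ[R] ReducedASAtInfinity R b n where
  toFun ω := limitClass b n (coneCochain R b n ω) (exists_mem_outsideCocycles b ω)
  map_add' _ _ := limitClass_add b _ _ _ (map_add _ _ _)
  map_smul' c _ := limitClass_smul b c _ _ (map_smul _ _ _)

/-- A coarse cocycle is trivial at infinity iff it is the coboundary of a cochain that is locally
zero at infinity. -/
theorem cocycleComparison_eq_zero_iff (b : X) {n : ℕ} (ω : coarseCocycles X R (n + 1)) :
    cocycleComparison R b n ω = 0 ↔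
      ∃ η : Cochain X R n, FarLocallyZero b η ∧ coboundary X R n η = ω := by
  have h := limitClass_eq_zero_iff b (exists_mem_outsideCocycles b ω)
  rw [coboundary_coneCochain b ω.2.2] at h
  exact h

theorem cocycleComparison_surjective (hunif : UniformlyAcyclicAtInfinity.{u, v} R X)
    (hloc : LocallyAcyclicAtInfinity.{u, v} R X) (b : X) (n : ℕ) :
    Function.Surjective (cocycleComparison R b n) := by
  intro z
  obtain ⟨φ, ⟨r, hφ⟩, rfl⟩ := exists_limitClass_eq b n z
  -- Applied to `dφ`, which is closed and locally zero at infinity; it becomes the coarse cocycle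
  -- `dφ - dψ`.
  obtain ⟨ψ, ⟨L, hL⟩, hω⟩ := exists_sub_coboundary_mem_coarseCochain hunif hloc b
    (farLocallyZero_iff.2 ⟨r, mem_outsideCocycles.1 hφ⟩)
    (by rw [coboundary_coboundary]; exact zero_mem _)
  have hcocycle : coboundary X R (n + 1) (coboundary X R n φ - coboundary X R n ψ) = 0 := by
    rw [map_sub, coboundary_coboundary, coboundary_coboundary, sub_zero]
  let ω : coarseCocycles X R (n + 1) := ⟨_, hω, hcocycle⟩
  obtain ⟨s, hs⟩ := exists_mem_outsideCocycles b ω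
  have hdiff : coneCochain R b n ω - φ ∈ outsideCocycles R b n (max r s) :=
    sub_mem (outsideCocycles_mono b n (le_max_right r s) hs)
      (outsideCocycles_mono b n (le_max_left r s) hφ)
  -- The cone of `ω` has coboundary `dφ - dψ`, so the difference has the same coboundary as `-ψ`,
  -- which is locally zero at infinity.
  have hzero : limitClass b n (coneCochain R b n ω - φ) ⟨_, hdiff⟩ = 0 := by
    refine (limitClass_eq_zero_iff b _).2 ⟨-ψ, ⟨L, fun y hy => ?_⟩, ?_⟩
    · obtain ⟨U, hU, h⟩ := hL y hy
      exact ⟨U, hU, fun x hx => by rw [Pi.neg_apply, h x hx, neg_zero]⟩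
    · rw [map_neg, map_sub, coboundary_coneCochain b ω.2.2]
      change _ = coboundary X R n φ - coboundary X R n ψ - _
      abel
  refine ⟨ω, (limitClass_add b ⟨r, hφ⟩ ⟨_, hdiff⟩ (exists_mem_outsideCocycles b ω)
    (add_sub_cancel _ _).symm).trans ?_⟩
  rw [hzero, add_zero]

theorem ker_cocycleComparison (hunif : UniformlyAcyclicAtInfinity.{u, v} R X)
    (hloc : LocallyAcyclicAtInfinity.{u, v} R X) (b : X) (n : ℕ) :
    LinearMap.ker (cocycleComparison R b n) =
      (coarseCoboundaries X R (n + 1)).submoduleOf (coarseCocycles X R (n + 1)) := by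
  ext ω
  rw [LinearMap.mem_ker, cocycleComparison_eq_zero_iff, Submodule.submoduleOf, Submodule.mem_comap]
  constructor
  · rintro ⟨η, hη, hηω⟩
    cases n with
    | zero => exact ⟨η, mem_coarseCochain_zero hη, hηω⟩
    | succ n =>
      -- Here `η` is corrected to the coarse cochain `η - dψ` without changing its coboundary `ω`.
      obtain ⟨ψ, -, hψ⟩ := exists_sub_coboundary_mem_coarseCochain hunif hloc b hη
        (by rw [hηω]; exact ω.2.1)
      exact ⟨_, hψ, by rw [map_sub, coboundary_coboundary, sub_zero, hηω]; rfl⟩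
  · rintro ⟨η, hη, hηω⟩
    exact ⟨η, farLocallyZero_of_mem_coarseCochain b hη, hηω⟩

/-- A 0-cocycle is constant, and a coarse one vanishes at points far away, which exist since `X` is
unbounded. -/
theorem subsingleton_HX_zero (hunbdd : ¬ Bornology.IsBounded (Set.univ : Set X)) (b : X) :
    Subsingleton (HX X R 0) := by
  refine Submodule.Quotient.subsingleton_iff.2 (eq_top_iff.2 fun φ _ => ?_)
  have hφ : (φ : Cochain X R 0) = 0 := by
    obtain ⟨M, hM⟩ := (mem_coarseCochain_iff b).1 φ.2.1 0 le_rfl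
    obtain ⟨x, hx⟩ : ∃ x : X, M ≤ dist x b := by
      by_contra! h
      exact hunbdd ((Metric.isBounded_iff_subset_closedBall b).2
        ⟨M, fun x _ => Metric.mem_closedBall.2 (h x).le⟩)
    rw [eq_constCochain_of_coboundary_eq_zero x φ.2.2, hM (fun _ => x) (by simp) hx, map_zero]
  exact hφ

end Comparison

end CoarseCohomology

end

theorem mainTheorem7 (X : Type u) [MetricSpace X] (R : Type v) [Ring R]
    (hunbdd : ¬ Bornology.IsBounded (Set.univ : Set X))
    (hunif : CoarseCohomology.UniformlyAcyclicAtInfinity R X)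
    (hloc : CoarseCohomology.LocallyAcyclicAtInfinity R X) (b : X) :
    Subsingleton (CoarseCohomology.HX X R 0) ∧
      ∀ n : ℕ, Nonempty
        (CoarseCohomology.HX X R (n + 1) ≃ₗ[R] CoarseCohomology.ReducedASAtInfinity R b n) :=
  ⟨CoarseCohomology.subsingleton_HX_zero hunbdd b, fun n =>
    ⟨(Submodule.quotEquivOfEq _ _ (CoarseCohomology.ker_cocycleComparison hunif hloc b n).symm).trans
      (LinearMap.quotKerEquivOfSurjective _
        (CoarseCohomology.cocycleComparison_surjective hunif hloc b n))⟩⟩
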